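/- **Definitions.** A hypergraph $G=(V,E)$ has a finite vertex set $V$ and finitely many hyperedges, each a subset of $V$ (parallel hyperedges are allowed). The degree of a vertex is the number of hyperedges containing it. Let $\mu\ge -1$ be real, $\eta\in\mathbb C$, $S\subseteq V$ and $\tau_S\in\{0,1\}^S$. The partition function of generalized weighted set cover is $$Z_{\tau_S}(G,\mu,\eta)=\sum_{\substack{\sigma\in\{0,1\}^V\\ \sigma(v)=\tau_S(v)\ \text{for}\ v\in S}}\ \prod_{e\in E}\Bigl(1+\mu\prod_{v\in e}(1-\sigma(v))\Bigr)\ \eta^{|\{v:\sigma(v)=0\}|}.$$ The pinning $\tau_S$ is feasible if $\mu\neq-1$, or if $\mu=-1$ and every hyperedge $e\subseteq S$ contains a vertex $v$ with $\tau_S(v)=1$. **Theorem.** Let $\Delta\ge 2$ be an integer and $\mu\ge-1$ real. Put $$\mu_1=\frac{e^{1+\frac1{\Delta-1}}}{\Delta-1},\qquad \mu_2=-\frac{e^{1-\frac1{\Delta-1}}}{\Delta-1},\qquad \psi(y)=\frac{\ln(1+y)}{y},$$ and let $\psi^{-1}:(0,1)\to(0,\infty)$ be the inverse of $\psi:(0,\infty)\to(0,1)$.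 * If $\mu>\mu_1$, let $x_1$ be the smallest real solution of $\frac{\mu x}{\mu+e^x}=\frac{\ln((\Delta-1)\mu)}{\Delta}$ and define $\eta_1(\Delta,\mu)$ by $$\frac1{\eta_1(\Delta,\mu)}=\psi^{-1}\!\left(\frac{x_1}{1+\mu e^{-x_1}}\right)\bigl(1+\mu e^{-x_1}\bigr)^{\Delta-1}.$$ * If $\mu<\mu_2$, let $x_2$ be the largest real solution of $$\ln\!\left(\frac{-(\Delta-1)x\mu e^{-x}}{2-x+2\mu e^{-x}}\right)\frac{1+\mu e^{-x}}{x-2-2\mu e^{-x}-(\Delta-1)x\mu e^{-x}}=1$$ (among those $x$ for which both denominators are nonzero and the logarithm is taken of a positive number) and define $\eta_2(\Delta,\mu)$ by $$\frac1{\eta_2(\Delta,\mu)}=\psi^{-1}\!\left(2-\frac{x_2}{1+\mu e^{-x_2}}\right)\bigl(1+\mu e^{-x_2}\bigr)^{\Delta-1}.$$ In the respective cases $x_1$, $x_2$ exist, the arguments of $\psi^{-1}$ lie in $(0,1)$, and $\eta_1,\eta_2$ are positive. Let $\eta_0>0$ and assume that one of the following holds: 1. $\mu\in[\mu_2,\mu_1]$;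 2. $\mu>\mu_1$ and $\eta_0<\eta_1(\Delta,\mu)$; 3. $\mu<\mu_2$ and $\eta_0<\eta_2(\Delta,\mu)$. Then there exists $\delta>0$, depending only on $\mu,\eta_0,\Delta$, such that $Z_{\tau_S}(G,\mu,\eta)\neq0$ for every $\eta\in\mathbb C\setminus\{0\}$ at distance less than $\delta$ from some point of the real interval $[0,\eta_0]$, every hypergraph $G$ of maximum degree at most $\Delta$, and every feasible pinning $\tau_S$ of a set $S$ of vertices of $G$. -/

import Mathlib

/-- A finite hypergraph with vertex type `V` and hyperedges indexed by `E`. Hyperedges are labelled,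
so that parallel hyperedges are allowed (different elements of a set cover instance may
lie in exactly the same sets). Simple hypergraphs are the case in which `verts` is injective. -/
structure CoverHypergraph (V E : Type*) where
  /-- the set of vertices of a hyperedge -/
  verts : E → Finset V

namespace CoverHypergraph

variable {V E : Type*} [Fintype V] [DecidableEq V] [Fintype E]

/-- The degree of a vertex: the number of hyperedges that contain it. -/
def degree (G : CoverHypergraph V E) (v : V) : ℕ :=
  (Finset.univ.filter fun e : E => v ∈ G.verts e).card

/-- The hyperedge activity `φ_e^μ(σ|_e) = 1 + μ ∏_{v ∈ e} (1 - σ(v))`. -/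
noncomputable def edgeActivity (G : CoverHypergraph V E) (μ : ℝ) (e : E) (σ : V → Fin 2) : ℂ :=
  1 + (μ : ℂ) * ∏ v ∈ G.verts e, (1 - ((σ v : ℕ) : ℂ))

/-- The partition function `Z_{τ_S}(G, μ, η)`: the sum over all `σ ∈ {0,1}^V` that agree with the
pinning `τ_S` on `S` of `∏_e φ_e^μ(σ|_e) · η^{#{v : σ(v) = 0}}`. -/
noncomputable def partitionFunction (G : CoverHypergraph V E) (μ : ℝ) (η : ℂ)
    (S : Finset V) (τ : S → Fin 2) : ℂ :=
  ∑ σ : V → Fin 2 with ∀ v : S, σ v = τ v,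
    (∏ e : E, G.edgeActivity μ e σ) * η ^ (Finset.univ.filter fun v : V => σ v = 0).card

/-- A pinning `τ_S` is feasible if, in the case `μ = -1`, every hyperedge all of whose vertices
are pinned has a vertex that is pinned to `1`. -/
def Feasible (G : CoverHypergraph V E) (μ : ℝ) (S : Finset V) (τ : S → Fin 2) : Prop :=
  μ = -1 → ∀ e : E, G.verts e ⊆ S → ∃ v : S, (v : V) ∈ G.verts e ∧ τ v = 1

end CoverHypergraph

namespace SetCover

/-- `μ₁ = e^{1 + 1/(Δ-1)} / (Δ-1)`. -/
noncomputable def mu1 (Δ : ℕ) : ℝ :=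
  Real.exp (1 + 1 / ((Δ : ℝ) - 1)) / ((Δ : ℝ) - 1)

/-- `μ₂ = - e^{1 - 1/(Δ-1)} / (Δ-1)`. -/
noncomputable def mu2 (Δ : ℕ) : ℝ :=
  -(Real.exp (1 - 1 / ((Δ : ℝ) - 1)) / ((Δ : ℝ) - 1))

/-- `ψ(y) = ln(1 + y) / y`. -/
noncomputable def psi (y : ℝ) : ℝ := Real.log (1 + y) / y

/-- The inverse of `ψ : (0, ∞) → (0, 1)`. -/
noncomputable def psiInv (c : ℝ) : ℝ := Function.invFunOn psi (Set.Ioi 0) c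

/-- The solutions of `μ x / (μ + e^x) = ln((Δ-1) μ) / Δ`. -/
def solutions1 (Δ : ℕ) (μ : ℝ) : Set ℝ :=
  {x | μ * x / (μ + Real.exp x) = Real.log (((Δ : ℝ) - 1) * μ) / (Δ : ℝ)}

/-- The smallest element of `solutions1 Δ μ`. -/
noncomputable def x1 (Δ : ℕ) (μ : ℝ) : ℝ := sInf (solutions1 Δ μ)

/-- The argument of `ψ⁻¹` in the definition of `η₁`. -/
noncomputable def arg1 (Δ : ℕ) (μ : ℝ) : ℝ :=
  x1 Δ μ / (1 + μ * Real.exp (-(x1 Δ μ)))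

/-- The threshold `η₁(Δ, μ)`, given by
`1 / η₁ = ψ⁻¹(x₁ / (1 + μ e^{-x₁})) (1 + μ e^{-x₁})^{Δ-1}`. -/
noncomputable def eta1 (Δ : ℕ) (μ : ℝ) : ℝ :=
  (psiInv (arg1 Δ μ) * (1 + μ * Real.exp (-(x1 Δ μ))) ^ (Δ - 1))⁻¹

/-- The argument of the logarithm in the equation for `x₂`. -/
noncomputable def logArg2 (Δ : ℕ) (μ x : ℝ) : ℝ :=
  -(((Δ : ℝ) - 1) * x * μ * Real.exp (-x)) / (2 - x + 2 * μ * Real.exp (-x))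

/-- The solutions of the equation for `x₂`. The first conjunct says that the logarithm is taken of
a positive number; a vanishing denominator in either fraction is excluded as well, since
division by zero gives zero. -/
def solutions2 (Δ : ℕ) (μ : ℝ) : Set ℝ :=
  {x | 0 < logArg2 Δ μ x ∧
    Real.log (logArg2 Δ μ x) *
      ((1 + μ * Real.exp (-x)) /
        (x - 2 - 2 * μ * Real.exp (-x) - ((Δ : ℝ) - 1) * x * μ * Real.exp (-x))) = 1}

/-- The largest element of `solutions2 Δ μ`. -/
noncomputable def x2 (Δ : ℕ) (μ : ℝ) : ℝ := sSup (solutions2 Δ μ)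

/-- The argument of `ψ⁻¹` in the definition of `η₂`. -/
noncomputable def arg2 (Δ : ℕ) (μ : ℝ) : ℝ :=
  2 - x2 Δ μ / (1 + μ * Real.exp (-(x2 Δ μ)))

/-- The threshold `η₂(Δ, μ)`, given by
`1 / η₂ = ψ⁻¹(2 - x₂ / (1 + μ e^{-x₂})) (1 + μ e^{-x₂})^{Δ-1}`. -/
noncomputable def eta2 (Δ : ℕ) (μ : ℝ) : ℝ :=
  (psiInv (arg2 Δ μ) * (1 + μ * Real.exp (-(x2 Δ μ))) ^ (Δ - 1))⁻¹

end SetCover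

/-! Put n = Δ − 1 and sum over the set A of vertices with value 0: a hyperedge f contributes 1 + μ
if f ⊆ A and 1 otherwise. Let a_f be the sum restricted to f ⊆ A divided by the full sum. Adding f
multiplies the full sum by 1 + μ a_f. A vertex v in at most n hyperedges has ratio F/(1+F), F = η ∏
(1 + μ aᵢ), where the aᵢ come from the hyperedges through v with v removed, on a smaller vertex set.
The ratio of a larger set is a product of vertex ratios by the chain rule. Hence zero-freeness
follows once some set of complex numbers is closed under products and this recursion and avoids the
zeros of 1 + μa and 1 + F (`StableSet.coverSum_ne_zero_and_div_mem`). The bound is n, not Δ, because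
the hyperedge being added uses up one unit of degree.

Near η = 0 a small disc serves, with the point 1 added if μ ≠ −1. Near a real η₀ > 0 take 0 and the
numbers e^{-s} with |s − ρ| ≤ ερ for a real ρ. Products add s and ρ, and the recursion outputs s =
log(1 + 1/F). Integrating its derivative along a path from the real point shows that this set is
preserved if Σ |μ| pᵢ(−log pᵢ)/(1 + μpᵢ) < (1+F) log(1 + 1/F) at real points
(`exists_stableSet_near_pos`). The right side depends only on the product of the 1 + μpᵢ and the
left side is concave in their logarithms, so Jensen reduces to equal pᵢ
(`contraction_of_univariate`).

With p = e^{-s}, C = 1/η₀ and y = 1/F = C/(1 + μe^{-s})^n, the condition is `rate` < `growth y`.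
Since `growth` exceeds 1, it holds whenever `rate` ≤ 1 everywhere, which is the case for μ ∈ [μ₂,
μ₁]. Otherwise the largest C at which it fails is attained at a point of tangency
(`exists_extremal`), and the tangency equations lead to those of x₁ and x₂. Compactness of [0, η₀]
then gives δ. -/

/-- The weighted sum over the sets `A ⊆ U` of zero vertices that contain `e`, where `L` is the
multiset of hyperedges. -/
noncomputable def coverSum {V : Type*} [DecidableEq V] (μ η : ℂ) (U : Finset V)
    (L : Multiset (Finset V)) (e : Finset V) : ℂ :=
  ∑ A ∈ U.powerset with e ⊆ A, η ^ A.card * (L.map fun f => 1 + if f ⊆ A then μ else 0).prod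

/-! ### Recursions for the weighted sums -/

section CoverSum

variable {V : Type*} [DecidableEq V] {μ η : ℂ}

theorem coverSum_cons (U : Finset V) (L : Multiset (Finset V)) (f : Finset V) :
    coverSum μ η U (f ::ₘ L) ∅ = coverSum μ η U L ∅ + μ * coverSum μ η U L f := by
  simp only [coverSum, Finset.sum_filter, Finset.mul_sum, ← Finset.sum_add_distrib]
  refine Finset.sum_congr rfl fun A _ => ?_
  simp only [Multiset.map_cons, Multiset.prod_cons, Finset.empty_subset, if_true]
  split_ifs <;> ring

theorem coverSum_empty_edges (U : Finset V) : coverSum μ η U 0 ∅ = (1 + η) ^ U.card := by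
  simp only [coverSum, Finset.empty_subset, Finset.filter_true, Multiset.map_zero,
    Multiset.prod_zero, mul_one]
  have := Finset.sum_pow_mul_eq_add_pow η 1 U
  simpa [add_comm] using this

theorem coverSum_of_notMem {U : Finset V} {e : Finset V} {v : V} (hv : v ∉ U) (hve : v ∈ e)
    (L : Multiset (Finset V)) : coverSum μ η U L e = 0 := by
  rw [coverSum, Finset.filter_false_of_mem, Finset.sum_empty]
  intro A hA h
  exact hv (Finset.mem_powerset.1 hA (h hve))

theorem coverSum_of_empty_mem {L : Multiset (Finset V)} (hL : ∅ ∈ L) (U e : Finset V) :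
    coverSum (-1) η U L e = 0 := by
  refine Finset.sum_eq_zero fun A _ => ?_
  have : (L.map fun f => (1 : ℂ) + if f ⊆ A then -1 else 0).prod = 0 :=
    Multiset.prod_eq_zero (Multiset.mem_map.2 ⟨∅, hL, by simp⟩)
  rw [this, mul_zero]

/-- Once v ∈ A, f ⊆ A is equivalent to f \ {v} ⊆ A \ {v}, so v can be removed from the vertex set
and from every hyperedge at the price of one factor η. -/
theorem coverSum_insert {U e : Finset V} {v : V} (hv : v ∈ U) (hve : v ∉ e)
    (L : Multiset (Finset V)) :
    coverSum μ η U L (insert v e) =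
      η * coverSum μ η (U.erase v) (L.map fun f => f.erase v) e := by
  simp only [coverSum, Finset.mul_sum]
  refine Finset.sum_bij' (fun A _ => A.erase v) (fun A _ => insert v A) ?_ ?_ ?_ ?_ ?_
  · intro A hA
    simp only [Finset.mem_filter, Finset.mem_powerset, Finset.insert_subset_iff] at hA ⊢
    exact ⟨Finset.erase_subset_erase _ hA.1, Finset.subset_erase.2 ⟨hA.2.2, hve⟩⟩
  · intro A hA
    simp only [Finset.mem_filter, Finset.mem_powerset] at hA ⊢
    refine ⟨Finset.insert_subset hv (hA.1.trans (Finset.erase_subset _ _)),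
      Finset.insert_subset_insert _ hA.2⟩
  · intro A hA
    simp only [Finset.mem_filter, Finset.mem_powerset, Finset.insert_subset_iff] at hA
    exact Finset.insert_erase hA.2.1
  · intro A hA
    simp only [Finset.mem_filter, Finset.mem_powerset] at hA
    exact Finset.erase_insert fun h => Finset.notMem_erase v U (hA.1 h)
  · intro A hA
    simp only [Finset.mem_filter, Finset.mem_powerset, Finset.insert_subset_iff] at hA
    have hc : A.card = (A.erase v).card + 1 := (Finset.card_erase_add_one hA.2.1).symm
    rw [hc, pow_succ, Multiset.map_map]
    have : ∀ f : Finset V, (f.erase v ⊆ A.erase v) ↔ f ⊆ A := fun f => by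
      rw [Finset.subset_erase, Finset.erase_subset_iff_of_mem hA.2.1]
      simp
    simp only [Function.comp_def, this]
    ring

/-- If v has value 1, the hyperedges through v have factor 1 and drop out; if it has value 0, they
shrink. -/
theorem coverSum_split {U : Finset V} {v : V} (hv : v ∈ U) (L : Multiset (Finset V)) :
    coverSum μ η U L ∅ = coverSum μ η (U.erase v) (L.filter fun f => v ∉ f) ∅ +
      η * coverSum μ η (U.erase v) (L.map fun f => f.erase v) ∅ := by
  rw [← coverSum_insert hv (Finset.notMem_empty v)]
  have key : coverSum μ η (U.erase v) (L.filter fun f => v ∉ f) ∅ =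
      ∑ A ∈ U.powerset with v ∉ A,
        η ^ A.card * (L.map fun f => 1 + if f ⊆ A then μ else 0).prod := by
    rw [coverSum]
    have hs : (U.powerset.filter fun A => v ∉ A) = (U.erase v).powerset := by
      ext A
      simp [Finset.subset_erase]
    rw [hs]
    simp only [Finset.empty_subset, Finset.filter_true]
    refine Finset.sum_congr rfl fun A hA => ?_
    have hvA : v ∉ A := fun h => Finset.notMem_erase v U (Finset.mem_powerset.1 hA h)
    congr 1
    induction L using Multiset.induction_on with
    | empty => simp
    | cons f L ih =>
      by_cases hf : v ∈ f
      · have : ¬ f ⊆ A := fun h => hvA (h hf)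
        simp [hf, ih, this]
      · simp [hf, ih]
  rw [key]
  simp only [coverSum, Finset.empty_subset, Finset.filter_true, Finset.insert_subset_iff,
    and_true]
  rw [add_comm, Finset.sum_filter_add_sum_filter_not]

/-! ### Zero-freeness from a stable set of ratios -/

/-- A multiplicatively closed set of complex numbers that is stable under the recursion
`p = F / (1 + F)`, `F = η ∏ᵢ (1 + μ aᵢ)` for the marginal of a vertex in at most `n` hyperedges. -/
structure StableSet (μ η : ℂ) (n : ℕ) (𝒢 : Set ℂ) : Prop where
  zero_mem : 0 ∈ 𝒢
  one_mem : μ ≠ -1 → 1 ∈ 𝒢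
  mul_mem : ∀ a ∈ 𝒢, ∀ b ∈ 𝒢, a * b ∈ 𝒢
  edge_ne_zero : ∀ a ∈ 𝒢, 1 + μ * a ≠ 0
  vertex_ne_zero : ∀ a : Fin n → ℂ, (∀ i, a i ∈ 𝒢) → 1 + η * ∏ i, (1 + μ * a i) ≠ 0
  vertex_mem : ∀ a : Fin n → ℂ, (∀ i, a i ∈ 𝒢) →
    (η * ∏ i, (1 + μ * a i)) / (1 + η * ∏ i, (1 + μ * a i)) ∈ 𝒢

/-- All degrees are at most `n + 1`, and there is no empty hyperedge if `μ = -1`. -/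
def EdgesAdmissible (μ : ℂ) (n : ℕ) (L : Multiset (Finset V)) : Prop :=
  (∀ v, L.countP (fun f => v ∈ f) ≤ n + 1) ∧ (μ = -1 → ∅ ∉ L)

theorem EdgesAdmissible.mono {n : ℕ} {L L' : Multiset (Finset V)} (h : EdgesAdmissible μ n L)
    (hL : L' ≤ L) : EdgesAdmissible μ n L' :=
  ⟨fun v => (Multiset.countP_le_of_le _ hL).trans (h.1 v),
    fun hμ h0 => h.2 hμ (Multiset.mem_of_le hL h0)⟩

theorem countP_map_erase_le (L : Multiset (Finset V)) (v w : V) :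
    (L.map fun f => f.erase v).countP (fun f => w ∈ f) ≤ L.countP (fun f => w ∈ f) := by
  rw [Multiset.countP_map, ← Multiset.countP_eq_card_filter]
  induction L using Multiset.induction_on with
  | empty => simp
  | cons f L ih =>
    rw [Multiset.countP_cons, Multiset.countP_cons]
    refine add_le_add ih ?_
    split_ifs with h1 h2 <;> simp_all

/-- The two terms of `coverSum_split` differ only by the shrunken hyperedges through v, so their
quotient is η times a product of edge factors. -/
theorem map_erase_eq_filter_add (L : Multiset (Finset V)) (v : V) :
    (L.map fun f => f.erase v) =
      (L.filter fun f => v ∉ f) + (L.filter fun f => v ∈ f).map fun f => f.erase v := by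
  conv_lhs => rw [← Multiset.filter_add_not (fun f => v ∈ f) L, Multiset.map_add, add_comm]
  congr 1
  conv_rhs => rw [← Multiset.map_id (L.filter fun f => v ∉ f)]
  exact Multiset.map_congr rfl fun f hf => Finset.erase_eq_of_notMem (Multiset.mem_filter.1 hf).2

/-- The factors contributed by a multiset `M` of additional hyperedges. -/
theorem exists_coverSum_add_eq {n : ℕ} {𝒢 : Set ℂ} (h𝒢 : StableSet μ η n 𝒢) {U : Finset V}
    {L M : Multiset (Finset V)} (hadm : EdgesAdmissible μ n (L + M))
    (hA : ∀ L, EdgesAdmissible μ n L → coverSum μ η U L ∅ ≠ 0)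
    (hC : ∀ L e, EdgesAdmissible μ n L → e.Nonempty →
      (∀ v ∈ e, L.countP (fun f => v ∈ f) ≤ n) →
      coverSum μ η U L e / coverSum μ η U L ∅ ∈ 𝒢) {k : ℕ} (hk : M.card ≤ k) :
    ∃ a : Fin k → ℂ, (∀ i, a i ∈ 𝒢) ∧
      coverSum μ η U (L + M) ∅ = coverSum μ η U L ∅ * ∏ i, (1 + μ * a i) := by
  induction M using Multiset.induction_on generalizing k with
  -- Unused slots are padded with a = 0, whose factor is 1.
  | empty => exact ⟨0, fun _ => h𝒢.zero_mem, by simp⟩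
  | cons f M ih =>
    rw [Multiset.card_cons] at hk
    obtain ⟨k, rfl⟩ : ∃ j, k = j + 1 := ⟨k - 1, by omega⟩
    have hadm' : EdgesAdmissible μ n (L + M) :=
      hadm.mono (add_le_add le_rfl (Multiset.le_cons_self _ _))
    obtain ⟨a, ha, hprod⟩ := ih hadm' (k := k) (by omega)
    have hne := hA _ hadm'
    have hf : coverSum μ η U (L + M) f / coverSum μ η U (L + M) ∅ ∈ 𝒢 := by
      rcases f.eq_empty_or_nonempty with rfl | hf
      · rw [div_self hne]
        exact h𝒢.one_mem fun hμ => hadm.2 hμ (by simp)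
      -- The hyperedge f itself accounts for one of the at most n + 1 incidences at each v ∈ f,
      -- which leaves n.
      · refine hC _ _ hadm' hf fun v hv => ?_
        have := hadm.1 v
        rw [Multiset.add_cons, Multiset.countP_cons, if_pos hv] at this
        omega
    refine ⟨Fin.cons (coverSum μ η U (L + M) f / coverSum μ η U (L + M) ∅) a, ?_, ?_⟩
    · intro i
      induction i using Fin.cases with
      | zero => simpa using hf
      | succ i => simpa using ha i
    · rw [Multiset.add_cons, coverSum_cons, Fin.prod_univ_succ]
      simp only [Fin.cons_zero, Fin.cons_succ]
      rw [mul_comm (1 + _), ← mul_assoc, ← hprod]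
      field_simp

/-- Adding the shrunken hyperedges one by one to those avoiding v writes the sum as z(1 + ηP) and
its part with v ∈ A as zηP, so the ratio is the recursion value with F = ηP. -/
theorem StableSet.marginal_mem {n : ℕ} {𝒢 : Set ℂ} (h𝒢 : StableSet μ η n 𝒢) {U : Finset V} {v : V}
    (hv : v ∈ U)
    (hA : ∀ L, EdgesAdmissible μ n L → coverSum μ η (U.erase v) L ∅ ≠ 0)
    (hC : ∀ L e, EdgesAdmissible μ n L → e.Nonempty →
      (∀ v ∈ e, L.countP (fun f => v ∈ f) ≤ n) →
      coverSum μ η (U.erase v) L e / coverSum μ η (U.erase v) L ∅ ∈ 𝒢)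
    {L : Multiset (Finset V)} (hL : EdgesAdmissible μ n L)
    (hdeg : L.countP (fun f => v ∈ f) ≤ n) :
    η * coverSum μ η (U.erase v) (L.map fun f => f.erase v) ∅ / coverSum μ η U L ∅ ∈ 𝒢 := by
  -- For μ = −1 a hyperedge contained in {v} forces v to have value 1, so the ratio is 0.
  by_cases h0 : μ = -1 ∧ ∅ ∈ L.map fun f => f.erase v
  · obtain ⟨rfl, h0⟩ := h0
    rw [coverSum_of_empty_mem h0]
    simpa using h𝒢.zero_mem
  have hadm : EdgesAdmissible μ n (L.map fun f => f.erase v) :=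
    ⟨fun w => (countP_map_erase_le L v w).trans (hL.1 w), fun hμ h => h0 ⟨hμ, h⟩⟩
  have h1 := map_erase_eq_filter_add L v
  obtain ⟨a, ha, hprod⟩ := exists_coverSum_add_eq h𝒢 (h1 ▸ hadm) hA hC (k := n)
    (by rwa [Multiset.card_map, ← Multiset.countP_eq_card_filter])
  rw [coverSum_split hv, h1, hprod]
  have hne := hA _ (hL.mono (Multiset.filter_le (fun f => v ∉ f) L))
  have h2 := h𝒢.vertex_mem a ha
  have h3 := h𝒢.vertex_ne_zero a ha
  convert h2 using 1
  generalize ∏ i, (1 + μ * a i) = P at *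
  generalize coverSum μ η (U.erase v) (L.filter fun f => v ∉ f) ∅ = z at *
  have h4 : z + η * (z * P) ≠ 0 := by
    have : z + η * (z * P) = z * (1 + η * P) := by ring
    rw [this]
    exact mul_ne_zero hne h3
  rw [div_eq_div_iff h4 h3]
  ring

/-- Induction on U. A ratio for e factors into the ratio of one v ∈ e times that of e \ {v} after v
is set to 0; closure under products keeps it in 𝒢. Nonvanishing then follows by adding hyperedges
one at a time to the edgeless sum (1 + η)^|U|. -/
theorem StableSet.coverSum_ne_zero_and_div_mem {n : ℕ} {𝒢 : Set ℂ} (h𝒢 : StableSet μ η n 𝒢)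
    (U : Finset V) :
    (∀ L, EdgesAdmissible μ n L → coverSum μ η U L ∅ ≠ 0) ∧
    (∀ L e, EdgesAdmissible μ n L → e.Nonempty →
      (∀ v ∈ e, L.countP (fun f => v ∈ f) ≤ n) →
      coverSum μ η U L e / coverSum μ η U L ∅ ∈ 𝒢) := by
  induction U using Finset.strongInduction with
  | H U ih =>
    have hC : ∀ L e, EdgesAdmissible μ n L → e.Nonempty →
        (∀ v ∈ e, L.countP (fun f => v ∈ f) ≤ n) →
        coverSum μ η U L e / coverSum μ η U L ∅ ∈ 𝒢 := by
      intro L e hL he hdeg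
      obtain ⟨v, hve⟩ := he
      by_cases hv : v ∈ U
      · obtain ⟨hA', hC'⟩ := ih _ (Finset.erase_ssubset hv)
        have hp := h𝒢.marginal_mem hv hA' hC' hL (hdeg v hve)
        rw [← Finset.insert_erase hve, coverSum_insert hv (Finset.notMem_erase v e)]
        rcases (e.erase v).eq_empty_or_nonempty with h0 | hne
        · rwa [h0]
        by_cases h0 : μ = -1 ∧ ∅ ∈ L.map fun f => f.erase v
        · obtain ⟨rfl, h0⟩ := h0
          rw [coverSum_of_empty_mem h0]
          simpa using h𝒢.zero_mem
        have hadm : EdgesAdmissible μ n (L.map fun f => f.erase v) :=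
          ⟨fun w => (countP_map_erase_le L v w).trans (hL.1 w), fun hμ h => h0 ⟨hμ, h⟩⟩
        have hq := hC' _ _ hadm hne fun w hw =>
          (countP_map_erase_le L v w).trans (hdeg w (Finset.mem_of_mem_erase hw))
        have := h𝒢.mul_mem _ hp _ hq
        convert this using 1
        have := hA' _ hadm
        field_simp
      · rw [coverSum_of_notMem hv hve]
        simpa using h𝒢.zero_mem
    refine ⟨fun L => ?_, hC⟩
    induction L using Multiset.induction_on with
    | empty =>
      intro _
      rw [coverSum_empty_edges]
      have := h𝒢.vertex_ne_zero 0 fun _ => h𝒢.zero_mem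
      exact pow_ne_zero _ (by simpa using this)
    | cons f L ihL =>
      intro hL
      have hL' := hL.mono (Multiset.le_cons_self L f)
      have hne := ihL hL'
      rw [coverSum_cons]
      have hf : coverSum μ η U L f / coverSum μ η U L ∅ ∈ 𝒢 := by
        rcases f.eq_empty_or_nonempty with rfl | hf
        · rw [div_self hne]
          exact h𝒢.one_mem fun hμ => hL.2 hμ (by simp)
        · refine hC _ _ hL' hf fun v hv => ?_
          have := hL.1 v
          rw [Multiset.countP_cons, if_pos hv] at this
          omega
      have := mul_ne_zero hne (h𝒢.edge_ne_zero _ hf)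
      convert this using 1
      field_simp

end CoverSum

/-! ### Removing the pinning -/

/-- Vertices pinned to 0 are deleted from the hyperedges. A vertex pinned to 1 stays in its
hyperedges but lies outside Sᶜ, so such a hyperedge is never contained in A ⊆ Sᶜ and has factor 1,
as it should. -/
theorem CoverHypergraph.partitionFunction_eq {V E : Type*} [Fintype V] [DecidableEq V] [Fintype E]
    (G : CoverHypergraph V E) (μ : ℝ) (η : ℂ) (S : Finset V) (τ : S → Fin 2)
    {Z : Finset V} (hZ : ∀ v, v ∈ Z ↔ ∃ h : v ∈ S, τ ⟨v, h⟩ = 0) :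
    G.partitionFunction μ η S τ =
      η ^ Z.card * coverSum μ η Sᶜ (Finset.univ.val.map fun e => G.verts e \ Z) ∅ := by
  have hZS : Z ⊆ S := fun v hv => ((hZ v).1 hv).1
  rw [partitionFunction, coverSum, Finset.mul_sum]
  simp only [Finset.empty_subset, Finset.filter_true]
  refine Finset.sum_bij' (fun σ _ => (Finset.univ.filter fun v => σ v = 0) \ S)
    (fun A _ v => if v ∈ A ∪ Z then 0 else 1) ?_ ?_ ?_ ?_ ?_
  · intro σ _
    rw [Finset.mem_powerset]
    intro v hv
    simpa using (Finset.mem_sdiff.1 hv).2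
  · intro A hA
    simp only [Finset.mem_filter, Finset.mem_univ, true_and]
    intro v
    have hvA : (v : V) ∉ A := fun h => by simpa using Finset.mem_powerset.1 hA h
    have h1 := hZ v
    have h2 : τ v = 0 ∨ τ v = 1 := by omega
    rcases h2 with h2 | h2 <;> simp_all
  · intro σ hσ
    simp only [Finset.mem_filter, Finset.mem_univ, true_and] at hσ
    funext v
    have h2 : σ v = 0 ∨ σ v = 1 := by omega
    by_cases hv : v ∈ S
    · have := hσ ⟨v, hv⟩
      have h1 := hZ v
      rcases h2 with h2 | h2 <;> simp_all
    · have : v ∉ Z := fun h => hv (hZS h)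
      rcases h2 with h2 | h2 <;> simp_all
  · intro A hA
    ext v
    simp only [Finset.mem_sdiff, Finset.mem_filter, Finset.mem_univ, true_and]
    have := @Finset.mem_powerset _ _ _ |>.1 hA
    have h1 : v ∈ A → v ∉ S := fun h => by simpa using this h
    have h2 : v ∈ Z → v ∈ S := fun h => hZS h
    clear hZ
    by_cases h3 : v ∈ A <;> by_cases h4 : v ∈ Z <;> simp_all
  · intro σ hσ
    simp only [Finset.mem_filter, Finset.mem_univ, true_and] at hσ
    have hσZ : ∀ v, v ∈ Z ↔ v ∈ S ∧ σ v = 0 := by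
      intro v
      rw [hZ]
      constructor
      · rintro ⟨h, h0⟩
        exact ⟨h, (hσ ⟨v, h⟩).trans h0⟩
      · rintro ⟨h, h0⟩
        exact ⟨h, (hσ ⟨v, h⟩).symm.trans h0⟩
    have hU : (Finset.univ.filter fun v => σ v = 0) =
        Z ∪ (Finset.univ.filter fun v => σ v = 0) \ S := by
      ext v
      simp only [Finset.mem_union, Finset.mem_sdiff, Finset.mem_filter, Finset.mem_univ, true_and,
        hσZ]
      tauto
    have hcard : (Finset.univ.filter fun v => σ v = 0).card =
        Z.card + ((Finset.univ.filter fun v => σ v = 0) \ S).card := by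
      conv_lhs => rw [hU]
      refine Finset.card_union_of_disjoint ?_
      rw [Finset.disjoint_left]
      intro v hv h
      exact (Finset.mem_sdiff.1 h).2 (hZS hv)
    rw [hcard, pow_add, Multiset.map_map]
    have hedge : ∀ e, G.edgeActivity μ e σ =
        1 + if G.verts e \ Z ⊆ (Finset.univ.filter fun v => σ v = 0) \ S then (μ : ℂ) else 0 := by
      intro e
      rw [edgeActivity]
      congr 1
      split_ifs with h
      · rw [Finset.prod_eq_one, mul_one]
        intro v hv
        have : σ v = 0 := by
          by_cases hvZ : v ∈ Z
          · exact ((hσZ v).1 hvZ).2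
          · have := h (Finset.mem_sdiff.2 ⟨hv, hvZ⟩)
            simp only [Finset.mem_sdiff, Finset.mem_filter, Finset.mem_univ, true_and] at this
            exact this.1
        simp [this]
      · obtain ⟨v, hv, hvn⟩ := Finset.not_subset.1 h
        have hv' := Finset.mem_sdiff.1 hv
        have : σ v ≠ 0 := by
          intro h0
          by_cases hvS : v ∈ S
          · exact hv'.2 ((hσZ v).2 ⟨hvS, h0⟩)
          · exact hvn (by simp [h0, hvS])
        have h1 : σ v = 1 := by omega
        rw [Finset.prod_eq_zero hv'.1 (by simp [h1]), mul_zero]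
    simp only [hedge, Function.comp_def]
    rw [Finset.prod]
    ring

theorem StableSet.partitionFunction_ne_zero {μ : ℝ} {η : ℂ} {n : ℕ} {𝒢 : Set ℂ}
    (h𝒢 : StableSet μ η n 𝒢) (hη : η ≠ 0) {V E : Type*} [Fintype V] [DecidableEq V] [Fintype E]
    (G : CoverHypergraph V E) (hdeg : ∀ v, G.degree v ≤ n + 1) (S : Finset V) (τ : S → Fin 2)
    (hτ : G.Feasible μ S τ) : G.partitionFunction μ η S τ ≠ 0 := by
  classical
  have hZ : ∀ v, v ∈ (Finset.univ.filter fun v => ∃ h : v ∈ S, τ ⟨v, h⟩ = 0) ↔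
      ∃ h : v ∈ S, τ ⟨v, h⟩ = 0 := fun v => by simp
  rw [G.partitionFunction_eq μ η S τ hZ]
  generalize (Finset.univ.filter fun v => ∃ h : v ∈ S, τ ⟨v, h⟩ = 0) = Z at hZ
  refine mul_ne_zero (pow_ne_zero _ hη) ((h𝒢.coverSum_ne_zero_and_div_mem Sᶜ).1 _ ⟨?_, ?_⟩)
  · intro v
    refine le_trans ?_ (hdeg v)
    rw [Multiset.countP_map, CoverHypergraph.degree, Finset.card_def, Finset.filter_val]
    refine Multiset.card_le_card (Multiset.monotone_filter_right _ fun e he => ?_)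
    exact (Finset.mem_sdiff.1 he).1
  -- A hyperedge emptied by the deletion has all its vertices pinned to 0, which feasibility forbids
  -- for μ = −1.
  · intro hμ h0
    obtain ⟨e, -, he⟩ := Multiset.mem_map.1 h0
    have hsub : G.verts e ⊆ Z := Finset.sdiff_eq_empty_iff_subset.1 he
    obtain ⟨v, hv, h1⟩ := hτ (by exact_mod_cast hμ) e fun v hv => ((hZ v).1 (hsub hv)).1
    obtain ⟨_, h2⟩ := (hZ v).1 (hsub hv)
    rw [h1] at h2
    exact absurd h2 (by decide)

/-! ### A stable set near activity 0 -/

/-- A disc of radius r with |μ|r < 1, together with 1 when μ ≠ −1. All its elements have norm at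
most 1, so a small η makes |F| ≤ r/2 and |1 + F| ≥ 1/2, which puts F/(1+F) back into the disc. -/
theorem exists_stableSet_near_zero {μ : ℝ} (hμ : -1 ≤ μ) (n : ℕ) :
    ∃ δ : ℝ, 0 < δ ∧ ∀ η : ℂ, ‖η‖ < δ → ∃ 𝒢, StableSet μ η n 𝒢 := by
  set r : ℝ := 1 / (2 * (1 + |μ|)) with hr
  have hpos : 0 < 1 + |μ| := by positivity
  have hr0 : 0 < r := by positivity
  have hr1 : r * (1 + |μ|) = 1 / 2 := by rw [hr]; field_simp
  have hr2 : |μ| * r < 1 := by nlinarith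
  have hr3 : r ≤ 1 / 2 := by nlinarith [abs_nonneg μ, mul_nonneg hr0.le (abs_nonneg μ)]
  refine ⟨r / 2 / (1 + |μ|) ^ n, by positivity, fun η hη =>
    ⟨{a | ‖a‖ ≤ r ∨ (μ ≠ -1 ∧ a = 1)}, ?_⟩⟩
  have hle : ∀ a ∈ {a : ℂ | ‖a‖ ≤ r ∨ (μ ≠ -1 ∧ a = 1)}, ‖a‖ ≤ 1 := by
    rintro a (h | ⟨-, rfl⟩)
    · linarith
    · simp
  have hF : ∀ a : Fin n → ℂ, (∀ i, a i ∈ {a : ℂ | ‖a‖ ≤ r ∨ (μ ≠ -1 ∧ a = 1)}) →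
      ‖η * ∏ i, (1 + (μ : ℂ) * a i)‖ ≤ r / 2 := by
    intro a ha
    have h1 : ‖∏ i, (1 + (μ : ℂ) * a i)‖ ≤ (1 + |μ|) ^ n := by
      rw [norm_prod]
      calc _ ≤ ∏ _i : Fin n, (1 + |μ|) := by
            refine Finset.prod_le_prod (fun _ _ => norm_nonneg _) fun i _ => ?_
            refine (norm_add_le _ _).trans ?_
            rw [norm_one, norm_mul, Complex.norm_real, Real.norm_eq_abs]
            gcongr
            exact mul_le_of_le_one_right (abs_nonneg _) (hle _ (ha i))
        _ = _ := by simp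
    rw [norm_mul]
    calc _ ≤ r / 2 / (1 + |μ|) ^ n * (1 + |μ|) ^ n := by gcongr
      _ = _ := by field_simp
  have hlow : ∀ a : Fin n → ℂ, (∀ i, a i ∈ {a : ℂ | ‖a‖ ≤ r ∨ (μ ≠ -1 ∧ a = 1)}) →
      1 / 2 ≤ ‖1 + η * ∏ i, (1 + (μ : ℂ) * a i)‖ := by
    intro a ha
    have h1 := hF a ha
    have h2 := norm_sub_le (1 + η * ∏ i, (1 + (μ : ℂ) * a i)) (η * ∏ i, (1 + (μ : ℂ) * a i))
    rw [add_sub_cancel_right, norm_one] at h2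
    linarith
  refine ⟨Or.inl (by simpa using hr0.le), fun h => Or.inr ⟨fun h' => h (by simp [h']), rfl⟩, ?_, ?_,
    ?_, ?_⟩
  · rintro a (ha | ⟨h, rfl⟩) b hb
    · left
      rw [norm_mul]
      nlinarith [hle b hb, norm_nonneg a, norm_nonneg b]
    · simpa using hb
  · rintro a (ha | ⟨h, rfl⟩) h0
    · have : ‖(μ : ℂ) * a‖ = 1 := by
        rw [← norm_neg, ← eq_neg_of_add_eq_zero_left h0, norm_one]
      rw [norm_mul, Complex.norm_real, Real.norm_eq_abs] at this
      nlinarith [abs_nonneg μ]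
    · apply h
      have h1 : (1 : ℝ) + μ = 0 := by
        rw [mul_one] at h0
        exact_mod_cast h0
      linarith
  · intro a ha h0
    have := hlow a ha
    rw [h0, norm_zero] at this
    linarith
  · intro a ha
    left
    rw [norm_div, div_le_iff₀ (by linarith [hlow a ha])]
    nlinarith [hlow a ha, hF a ha]

/-! ### Stable sets near a positive activity -/

theorem norm_cexp_sub_one_le (u : ℂ) : ‖Complex.exp u - 1‖ ≤ ‖u‖ * Real.exp ‖u‖ := by
  have := Complex.norm_exp_sub_sum_le_norm_mul_exp u 1
  simpa using this

/-- Relative perturbations of `ρ ≥ 0` change `e^{-ρ}` and `ρ e^{-ρ}` uniformly little. -/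
theorem norm_cexp_neg_sub_le {ε ρ : ℝ} (hε : ε ≤ 1 / 2) (hε0 : 0 ≤ ε) (hρ : 0 ≤ ρ) {s : ℂ}
    (hs : ‖s - ρ‖ ≤ ε * ρ) :
    ‖Complex.exp (-s) - (Real.exp (-ρ) : ℂ)‖ ≤ 16 * ε ∧
      ‖ρ * Complex.exp (-s) - (Real.negMulLog (Real.exp (-ρ)) : ℂ)‖ ≤ 16 * ε := by
  have h1 : ‖Complex.exp (-s) - (Real.exp (-ρ) : ℂ)‖ ≤ ε * (ρ * Real.exp (-(ρ / 2))) := by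
    have h2 : Complex.exp (-s) - (Real.exp (-ρ) : ℂ) =
        (Real.exp (-ρ) : ℂ) * (Complex.exp (-(s - ρ)) - 1) := by
      rw [mul_sub, mul_one, Complex.ofReal_exp, ← Complex.exp_add]
      congr 2
      push_cast
      ring
    rw [h2, norm_mul, Complex.norm_real, Real.norm_of_nonneg (Real.exp_pos _).le]
    calc _ ≤ Real.exp (-ρ) * (‖s - ρ‖ * Real.exp ‖s - ρ‖) := by
          gcongr
          have := norm_cexp_sub_one_le (-(s - ρ))
          rwa [norm_neg] at this
      _ ≤ Real.exp (-ρ) * (ε * ρ * Real.exp (ρ / 2)) := by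
          gcongr
          exact hs.trans (by nlinarith)
      _ = ε * (ρ * (Real.exp (-ρ) * Real.exp (ρ / 2))) := by ring
      _ = _ := by
          rw [← Real.exp_add]
          congr 3
          ring
  -- Source of the constant 16: ρ² e^{-ρ/2} = 16 (ρ/4 · e^{-ρ/4})², and the squared quantity is at
  -- most 1.
  have h4 : ρ / 4 * Real.exp (-(ρ / 4)) ≤ 1 := by
    have := Real.add_one_le_exp (ρ / 4)
    rw [Real.exp_neg, ← div_eq_mul_inv, div_le_one (Real.exp_pos _)]
    linarith
  have h5 : Real.exp (-(ρ / 2)) = Real.exp (-(ρ / 4)) * Real.exp (-(ρ / 4)) := by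
    rw [← Real.exp_add]
    congr 1
    ring
  have h6 : 0 ≤ ρ / 4 * Real.exp (-(ρ / 4)) := by positivity
  have h7 : Real.exp (-(ρ / 4)) ≤ 1 := Real.exp_le_one_iff.2 (by linarith)
  constructor
  · refine h1.trans ?_
    have : ρ * Real.exp (-(ρ / 2)) ≤ 16 := by
      rw [h5]
      nlinarith [Real.exp_pos (-(ρ / 4))]
    nlinarith
  · have h8 : ρ * Complex.exp (-s) - (Real.negMulLog (Real.exp (-ρ)) : ℂ) =
        ρ * (Complex.exp (-s) - (Real.exp (-ρ) : ℂ)) := by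
      rw [Real.negMulLog, Real.log_exp]
      push_cast
      ring
    rw [h8, norm_mul, Complex.norm_real, Real.norm_of_nonneg hρ]
    calc _ ≤ ρ * (ε * (ρ * Real.exp (-(ρ / 2)))) := by gcongr
      _ = 16 * ε * (ρ / 4 * Real.exp (-(ρ / 4))) ^ 2 := by rw [h5]; ring
      _ ≤ 16 * ε * 1 := by
          gcongr
          exact pow_le_one₀ h6 h4
      _ = _ := mul_one _

/-- The numbers `e^{-s}` with `s` relatively `ε`-close to a real `ρ ≥ -log pm`, and zero. -/
def relNhds (ε pm : ℝ) : Set ℂ :=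
  {a | a = 0 ∨ ∃ (s : ℂ) (ρ : ℝ), 0 ≤ ρ ∧ Real.exp (-ρ) ≤ pm ∧ ‖s - ρ‖ ≤ ε * ρ ∧
    a = Complex.exp (-s)}

/-- The condition |s − ρ| ≤ ερ is additive in (s, ρ); an absolute bound on s − ρ would not survive
products. -/
theorem mul_mem_relNhds {ε pm : ℝ} {a b : ℂ} (ha : a ∈ relNhds ε pm) (hb : b ∈ relNhds ε pm) :
    a * b ∈ relNhds ε pm := by
  rcases ha with rfl | ⟨s, ρ, h0, h1, h2, rfl⟩
  · exact Or.inl (zero_mul _)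
  rcases hb with rfl | ⟨s', ρ', h0', h1', h2', rfl⟩
  · exact Or.inl (mul_zero _)
  refine Or.inr ⟨s + s', ρ + ρ', by positivity, (Real.exp_le_exp.2 (by linarith)).trans h1, ?_, ?_⟩
  · push_cast
    rw [add_sub_add_comm, mul_add]
    exact (norm_add_le _ _).trans (add_le_add h2 h2')
  · rw [← Complex.exp_add, neg_add]

/-- Paths from the real point underlying an element of `relNhds ε pm` to that element. -/
theorem exists_path_of_mem_relNhds {ε pm : ℝ} (hε0 : 0 ≤ ε) (hε : ε ≤ 1 / 2) (hpm : 0 ≤ pm) {a : ℂ}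
    (ha : a ∈ relNhds ε pm) :
    ∃ p ∈ Set.Icc 0 pm, ∃ α α' β : ℝ → ℂ, α 0 = (p : ℂ) ∧ α 1 = a ∧ ∀ t ∈ Set.Icc (0 : ℝ) 1,
      HasDerivAt α (α' t) t ∧ ‖α' t‖ ≤ ε * ‖β t‖ ∧ ‖α t - p‖ ≤ 16 * ε ∧
        ‖β t - (Real.negMulLog p : ℂ)‖ ≤ 16 * ε := by
  rcases ha with rfl | ⟨s, ρ, h0, h1, h2, rfl⟩
  · refine ⟨0, ⟨le_rfl, hpm⟩, fun _ => 0, fun _ => 0, fun _ => 0, by simp, rfl, fun t _ =>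
      ⟨hasDerivAt_const _ _, by simp, by simpa using hε0, by simpa using hε0⟩⟩
  -- The path is the segment from ρ to s in the exponent. With β = ρ e^{-s_t} the speed is at most
  -- ε|β|, and β stays near ρ e^{-ρ} = −p log p.
  · refine ⟨Real.exp (-ρ), ⟨(Real.exp_pos _).le, h1⟩,
      fun t => Complex.exp (-((ρ : ℂ) + t * (s - ρ))),
      fun t => Complex.exp (-((ρ : ℂ) + t * (s - ρ))) * -(s - ρ),
      fun t => ρ * Complex.exp (-((ρ : ℂ) + t * (s - ρ))), by simp, by simp, fun t ht => ?_⟩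
    have hs : ‖(ρ : ℂ) + t * (s - ρ) - ρ‖ ≤ ε * ρ := by
      rw [add_sub_cancel_left, norm_mul, Complex.norm_real, Real.norm_of_nonneg ht.1]
      exact (mul_le_of_le_one_left (norm_nonneg _) ht.2).trans h2
    refine ⟨?_, ?_, norm_cexp_neg_sub_le hε hε0 h0 hs⟩
    · have h3 : HasDerivAt (fun t : ℝ => (t : ℂ)) 1 t := Complex.ofRealCLM.hasDerivAt
      have h4 := ((h3.mul_const (s - ρ)).const_add (ρ : ℂ)).neg.cexp
      simpa using h4
    · rw [norm_mul, norm_mul, norm_neg, Complex.norm_real, Real.norm_of_nonneg h0]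
      nlinarith [norm_nonneg (Complex.exp (-((ρ : ℂ) + t * (s - ρ))))]

/-- The derivative of log(1 + 1/F) is −(F'/F)/(1 + F), and F'/F is the sum of the logarithmic
derivatives of the factors; the mean value inequality concludes. -/
theorem norm_log_sub_le_of_path {n : ℕ} {μ C : ℝ} {w w' : ℝ → ℂ} {α α' : Fin n → ℝ → ℂ}
    (hw : ∀ t ∈ Set.Icc (0 : ℝ) 1, HasDerivAt w (w' t) t)
    (hα : ∀ i, ∀ t ∈ Set.Icc (0 : ℝ) 1, HasDerivAt (α i) (α' i t) t)
    (hw0 : ∀ t ∈ Set.Icc (0 : ℝ) 1, w t ≠ 0)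
    (hα0 : ∀ i, ∀ t ∈ Set.Icc (0 : ℝ) 1, 1 + (μ : ℂ) * α i t ≠ 0)
    (hslit : ∀ t ∈ Set.Icc (0 : ℝ) 1,
      1 + (w t * ∏ i, (1 + (μ : ℂ) * α i t))⁻¹ ∈ Complex.slitPlane)
    (hC : ∀ t ∈ Set.Icc (0 : ℝ) 1,
      (‖w' t‖ / ‖w t‖ + ∑ i, ‖(μ : ℂ) * α' i t / (1 + μ * α i t)‖) /
        ‖1 + w t * ∏ i, (1 + (μ : ℂ) * α i t)‖ ≤ C) :
    ‖Complex.log (1 + (w 1 * ∏ i, (1 + (μ : ℂ) * α i 1))⁻¹) -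
      Complex.log (1 + (w 0 * ∏ i, (1 + (μ : ℂ) * α i 0))⁻¹)‖ ≤ C := by
  have hF : ∀ t ∈ Set.Icc (0 : ℝ) 1, HasDerivAt (fun t => w t * ∏ i, (1 + (μ : ℂ) * α i t))
      ((w t * ∏ i, (1 + (μ : ℂ) * α i t)) *
        (w' t / w t + ∑ i, (μ : ℂ) * α' i t / (1 + μ * α i t))) t := by
    intro t ht
    have h1 : ∀ i ∈ (Finset.univ : Finset (Fin n)),
        HasDerivAt (fun t => 1 + (μ : ℂ) * α i t) (μ * α' i t) t :=
      fun i _ => ((hα i t ht).const_mul (μ : ℂ)).const_add 1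
    have h2 := (hw t ht).mul (HasDerivAt.fun_finsetProd h1)
    refine h2.congr_deriv ?_
    rw [mul_add]
    congr 1
    · field_simp [hw0 t ht]
    · rw [mul_assoc]
      congr 1
      rw [Finset.mul_sum]
      refine Finset.sum_congr rfl fun i _ => ?_
      rw [← Finset.mul_prod_erase _ _ (Finset.mem_univ i), smul_eq_mul]
      have := hα0 i t ht
      field_simp
  refine norm_image_sub_le_of_norm_deriv_le_segment_01'
    (f := fun t => Complex.log (1 + (w t * ∏ i, (1 + (μ : ℂ) * α i t))⁻¹))
    (f' := fun t => -((w t * ∏ i, (1 + (μ : ℂ) * α i t)) *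
        (w' t / w t + ∑ i, (μ : ℂ) * α' i t / (1 + μ * α i t))) /
        (w t * ∏ i, (1 + (μ : ℂ) * α i t)) ^ 2 /
        (1 + (w t * ∏ i, (1 + (μ : ℂ) * α i t))⁻¹)) ?_ ?_
  · intro t ht
    have hne : w t * ∏ i, (1 + (μ : ℂ) * α i t) ≠ 0 :=
      mul_ne_zero (hw0 t ht) (Finset.prod_ne_zero_iff.2 fun i _ => hα0 i t ht)
    exact ((((hF t ht).fun_inv hne).const_add 1).clog_real (hslit t ht)).hasDerivWithinAt
  · intro t ht
    have ht' := Set.Ico_subset_Icc_self ht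
    refine le_trans ?_ (hC t ht')
    have hne : w t * ∏ i, (1 + (μ : ℂ) * α i t) ≠ 0 :=
      mul_ne_zero (hw0 t ht') (Finset.prod_ne_zero_iff.2 fun i _ => hα0 i t ht')
    have hne1 := Complex.slitPlane_ne_zero (hslit t ht')
    have h1 : ‖w' t / w t + ∑ i, (μ : ℂ) * α' i t / (1 + μ * α i t)‖ ≤
        ‖w' t‖ / ‖w t‖ + ∑ i, ‖(μ : ℂ) * α' i t / (1 + μ * α i t)‖ := by
      refine (norm_add_le _ _).trans (add_le_add (norm_div _ _).le (norm_sum_le _ _))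
    refine le_trans (le_of_eq ?_) (div_le_div_of_nonneg_right h1 (norm_nonneg _))
    rw [← norm_div]
    generalize w t * ∏ i, (1 + (μ : ℂ) * α i t) = F at *
    generalize w' t / w t + ∑ i, (μ : ℂ) * α' i t / (1 + μ * α i t) = D
    have h2 : 1 + F ≠ 0 := by
      have : 1 + F = F * (1 + F⁻¹) := by field_simp; ring
      rw [this]
      exact mul_ne_zero hne hne1
    rw [← norm_neg]
    congr 1
    have h3 : F + 1 ≠ 0 := by rwa [add_comm]
    field_simp
    ring

/-- The perturbation parameters: edge factors and their derivatives, the activity, the speed of the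
activity, and the underlying real point. -/
abbrev PerturbationSpace (n : ℕ) : Type :=
  (Fin n → ℂ) × (Fin n → ℂ) × ℂ × ℝ × (Fin n → ℝ)

/-- All four conclusions are open and hold at the unperturbed real data, the last one being H
divided by 1 + F. Compactness of [0, pm]^n makes the radius uniform. -/
theorem exists_uniform_nhds {n : ℕ} {μ η₀ pm : ℝ} (hη₀ : 0 < η₀) (hpm : pm ≤ 1)
    (hpos : ∀ p ∈ Set.Icc 0 pm, 0 < 1 + μ * p)
    (H : ∀ p : Fin n → ℝ, (∀ i, p i ∈ Set.Icc 0 pm) →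
      ∑ i, |μ| * Real.negMulLog (p i) / (1 + μ * p i) <
        (1 + η₀ * ∏ i, (1 + μ * p i)) * Real.log (1 + (η₀ * ∏ i, (1 + μ * p i))⁻¹)) :
    ∃ ε : ℝ, 0 < ε ∧ ∀ p : Fin n → ℝ, (∀ i, p i ∈ Set.Icc 0 pm) →
      ∀ (a b : Fin n → ℂ) (η : ℂ) (e : ℝ), (∀ i, ‖a i - p i‖ < ε) →
        (∀ i, ‖b i - (Real.negMulLog (p i) : ℂ)‖ < ε) → ‖η - η₀‖ < ε → |e| < ε →
        (∀ i, 1 + (μ : ℂ) * a i ≠ 0) ∧ η ≠ 0 ∧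
        1 + (η * ∏ i, (1 + (μ : ℂ) * a i))⁻¹ ∈ Complex.slitPlane ∧
        (e / ‖η‖ + ∑ i, ‖(μ : ℂ) * b i / (1 + μ * a i)‖) / ‖1 + η * ∏ i, (1 + (μ : ℂ) * a i)‖ <
          Real.log (1 + (η₀ * ∏ i, (1 + μ * p i))⁻¹) := by
  let P : PerturbationSpace n → Prop := fun z =>
    (∀ i, 1 + (μ : ℂ) * z.1 i ≠ 0) ∧ z.2.2.1 ≠ 0 ∧
      1 + (z.2.2.1 * ∏ i, (1 + (μ : ℂ) * z.1 i))⁻¹ ∈ Complex.slitPlane ∧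
      (z.2.2.2.1 / ‖z.2.2.1‖ + ∑ i, ‖(μ : ℂ) * z.2.1 i / (1 + μ * z.1 i)‖) /
        ‖1 + z.2.2.1 * ∏ i, (1 + (μ : ℂ) * z.1 i)‖ <
          Real.log (1 + (η₀ * ∏ i, (1 + μ * z.2.2.2.2 i))⁻¹)
  let f : (Fin n → ℝ) → PerturbationSpace n := fun p =>
    (fun i => (p i : ℂ), fun i => (Real.negMulLog (p i) : ℂ), (η₀ : ℂ), 0, p)
  have hf : Continuous f := by
    have := Real.continuous_negMulLog
    fun_prop
  let B : Set (Fin n → ℝ) := Set.pi Set.univ fun _ => Set.Icc 0 pm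
  have hB : IsCompact (f '' B) := (isCompact_univ_pi fun _ => isCompact_Icc).image hf
  have hsub : f '' B ⊆ interior {z | P z} := by
    rintro _ ⟨p, hp, rfl⟩
    have hp' : ∀ i, p i ∈ Set.Icc 0 pm := fun i => hp i (Set.mem_univ i)
    have hprod : 0 < ∏ i, (1 + μ * p i) := Finset.prod_pos fun i _ => hpos _ (hp' i)
    set F := η₀ * ∏ i, (1 + μ * p i) with hFdef
    have hF : 0 < F := mul_pos hη₀ hprod
    have hFc : (η₀ : ℂ) * ∏ i, (1 + (μ : ℂ) * (p i : ℂ)) = (F : ℂ) := by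
      rw [hFdef]
      push_cast
      rfl
    have hedge : ∀ i, 1 + (μ : ℂ) * (p i : ℂ) ≠ 0 := fun i => by
      have := (hpos _ (hp' i)).ne'
      exact_mod_cast this
    have hη₀c : (η₀ : ℂ) ≠ 0 := by exact_mod_cast hη₀.ne'
    have hFc0 : (F : ℂ) ≠ 0 := by exact_mod_cast hF.ne'
    rw [mem_interior_iff_mem_nhds]
    have hc3 : Continuous fun z : PerturbationSpace n => z.2.2.1 := by fun_prop
    have hc4 : Continuous fun z : PerturbationSpace n => z.2.2.2.1 := by fun_prop
    have hcF : Continuous fun z : PerturbationSpace n =>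
        z.2.2.1 * ∏ i, (1 + (μ : ℂ) * z.1 i) := by fun_prop
    have e1 : ∀ᶠ z in nhds (f p), ∀ i, 1 + (μ : ℂ) * z.1 i ≠ 0 := by
      rw [Filter.eventually_all]
      intro i
      have : Continuous fun z : PerturbationSpace n => 1 + (μ : ℂ) * z.1 i := by fun_prop
      exact this.continuousAt.eventually_ne (hedge i)
    have e2 : ∀ᶠ z in nhds (f p), z.2.2.1 ≠ 0 := hc3.continuousAt.eventually_ne hη₀c
    have e3 : ∀ᶠ z in nhds (f p),
        1 + (z.2.2.1 * ∏ i, (1 + (μ : ℂ) * z.1 i))⁻¹ ∈ Complex.slitPlane := by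
      have hc : ContinuousAt (fun z : PerturbationSpace n =>
          1 + (z.2.2.1 * ∏ i, (1 + (μ : ℂ) * z.1 i))⁻¹) (f p) := by
        refine continuousAt_const.add (hcF.continuousAt.inv₀ ?_)
        simp only [f]
        rw [hFc]
        exact hFc0
      refine hc.eventually_mem (Complex.isOpen_slitPlane.mem_nhds ?_)
      simp only [f]
      rw [hFc]
      left
      rw [← Complex.ofReal_inv, ← Complex.ofReal_one, ← Complex.ofReal_add, Complex.ofReal_re]
      positivity
    have e4 : ∀ᶠ z in nhds (f p),
        (z.2.2.2.1 / ‖z.2.2.1‖ + ∑ i, ‖(μ : ℂ) * z.2.1 i / (1 + μ * z.1 i)‖) /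
          ‖1 + z.2.2.1 * ∏ i, (1 + (μ : ℂ) * z.1 i)‖ <
          Real.log (1 + (η₀ * ∏ i, (1 + μ * z.2.2.2.2 i))⁻¹) := by
      have h1F : ‖1 + (F : ℂ)‖ = 1 + F := by
        rw [← Complex.ofReal_one, ← Complex.ofReal_add, Complex.norm_real,
          Real.norm_of_nonneg (by positivity)]
      refine ContinuousAt.eventually_lt ?_ ?_ ?_
      · refine ContinuousAt.div (ContinuousAt.add (hc4.continuousAt.div hc3.norm.continuousAt ?_)
          ?_) (continuous_const.add hcF).norm.continuousAt ?_
        · exact norm_ne_zero_iff.2 hη₀c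
        · refine tendsto_finsetSum _ fun i _ => ?_
          refine (ContinuousAt.div (f := fun z : PerturbationSpace n => (μ : ℂ) * z.2.1 i)
            (g := fun z : PerturbationSpace n => 1 + (μ : ℂ) * z.1 i) ?_ ?_ (hedge i)).norm
          · exact (by fun_prop : Continuous fun z : PerturbationSpace n =>
              (μ : ℂ) * z.2.1 i).continuousAt
          · exact (by fun_prop : Continuous fun z : PerturbationSpace n =>
              1 + (μ : ℂ) * z.1 i).continuousAt
        · simp only [f]
          rw [hFc, h1F]
          positivity
      · have hcr : Continuous fun z : PerturbationSpace n =>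
            η₀ * ∏ i, (1 + μ * z.2.2.2.2 i) := by fun_prop
        refine ContinuousAt.log (continuousAt_const.add (hcr.continuousAt.inv₀ hF.ne')) ?_
        simp only [f]
        rw [← hFdef]
        positivity
      · simp only [f]
        rw [hFc, h1F, zero_div, zero_add, div_lt_iff₀ (by positivity), ← hFdef]
        have := H p hp'
        rw [← hFdef, mul_comm] at this
        refine lt_of_eq_of_lt (Finset.sum_congr rfl fun i _ => ?_) this
        have h1 : (1 : ℂ) + μ * p i = ((1 + μ * p i : ℝ) : ℂ) := by push_cast; rfl
        rw [h1, norm_div, norm_mul, Complex.norm_real, Complex.norm_real, Complex.norm_real,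
          Real.norm_of_nonneg (hpos _ (hp' i)).le, Real.norm_eq_abs, Real.norm_of_nonneg
            (Real.negMulLog_nonneg (hp' i).1 ((hp' i).2.trans hpm))]
    filter_upwards [e1, e2, e3, e4] with z h1 h2 h3 h4 using ⟨h1, h2, h3, h4⟩
  obtain ⟨ε, hε, hthick⟩ := hB.exists_thickening_subset_open isOpen_interior hsub
  refine ⟨ε, hε, fun p hp a b η e ha hb hη he => ?_⟩
  have hmem : ((a, b, η, e, p) : PerturbationSpace n) ∈ Metric.thickening ε (f '' B) := by
    rw [Metric.mem_thickening_iff]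
    refine ⟨f p, ⟨p, fun i _ => hp i, rfl⟩, ?_⟩
    simp only [f, Prod.dist_eq, max_lt_iff, dist_self, dist_pi_lt_iff hε]
    simp only [dist_eq_norm, sub_zero, Real.norm_eq_abs]
    exact ⟨ha, hb, hη, he, hε⟩
  have hP := interior_subset (hthick hmem)
  exact hP

/-- The output F/(1+F) equals e^{-s} with s = log(1 + 1/F), and the underlying real output has ρ =
log(1 + 1/F₀). Path speeds are ε times the quantities controlled by `exists_uniform_nhds`, so |s −
ρ| ≤ ερ again; `hclosed` keeps e^{-ρ} ≤ pm. -/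
theorem exists_stableSet_near_pos {n : ℕ} (hn : 1 ≤ n) {μ η₀ pm : ℝ} (hη₀ : 0 < η₀)
    (hpm : 0 ≤ pm) (hpm' : pm ≤ 1) (hpm1 : μ ≠ -1 → pm = 1)
    (hpos : ∀ p ∈ Set.Icc 0 pm, 0 < 1 + μ * p)
    (hclosed : ∀ p : Fin n → ℝ, (∀ i, p i ∈ Set.Icc 0 pm) →
      η₀ * ∏ i, (1 + μ * p i) ≤ pm * (1 + η₀ * ∏ i, (1 + μ * p i)))
    (H : ∀ p : Fin n → ℝ, (∀ i, p i ∈ Set.Icc 0 pm) →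
      ∑ i, |μ| * Real.negMulLog (p i) / (1 + μ * p i) <
        (1 + η₀ * ∏ i, (1 + μ * p i)) * Real.log (1 + (η₀ * ∏ i, (1 + μ * p i))⁻¹)) :
    ∃ δ : ℝ, 0 < δ ∧ ∀ η : ℂ, ‖η - η₀‖ < δ → ∃ 𝒢, StableSet μ η n 𝒢 := by
  obtain ⟨ε', hε', hU⟩ := exists_uniform_nhds hη₀ hpm' hpos H
  set ε : ℝ := min (1 / 2) (ε' / 32) with hε
  have hε0 : 0 < ε := by positivity
  have hε1 : ε ≤ 1 / 2 := min_le_left _ _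
  have hε2 : 16 * ε < ε' := by
    have : ε ≤ ε' / 32 := min_le_right _ _
    linarith
  -- The activity also moves along the path; its speed |η − η₀| must carry a factor ε, leaving ε'/2
  -- as the parameter e of the uniform bound.
  refine ⟨ε * (ε' / 2), by positivity, fun η hη => ⟨relNhds ε pm, ?_⟩⟩
  have hηε : ‖η - η₀‖ < ε' := hη.trans (by nlinarith)
  have main : ∀ a : Fin n → ℂ, (∀ i, a i ∈ relNhds ε pm) →
      (∀ i, 1 + (μ : ℂ) * a i ≠ 0) ∧ 1 + η * ∏ i, (1 + (μ : ℂ) * a i) ≠ 0 ∧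
      (η * ∏ i, (1 + (μ : ℂ) * a i)) / (1 + η * ∏ i, (1 + (μ : ℂ) * a i)) ∈ relNhds ε pm := by
    intro a ha
    choose p hp α α' β hα0 hα1 hα using fun i =>
      exists_path_of_mem_relNhds hε0.le hε1 hpm (ha i)
    have hfacts : ∀ t ∈ Set.Icc (0 : ℝ) 1, _ := fun t ht =>
      hU p hp (fun i => α i t) (fun i => β i t) ((η₀ : ℂ) + t * (η - η₀)) (ε' / 2)
        (fun i => ((hα i t ht).2.2.1).trans_lt hε2) (fun i => ((hα i t ht).2.2.2).trans_lt hε2)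
        (by
          rw [add_sub_cancel_left, norm_mul, Complex.norm_real, Real.norm_of_nonneg ht.1]
          exact (mul_le_of_le_one_left (norm_nonneg _) ht.2).trans_lt hηε)
        (by rw [abs_of_pos (by positivity)]; linarith)
    have hprod : 0 < ∏ i, (1 + μ * p i) := Finset.prod_pos fun i _ => hpos _ (hp i)
    set F₀ := η₀ * ∏ i, (1 + μ * p i) with hF₀def
    have hF₀ : 0 < F₀ := mul_pos hη₀ hprod
    have hdist := norm_log_sub_le_of_path (μ := μ) (C := ε * Real.log (1 + F₀⁻¹))
      (w := fun t => (η₀ : ℂ) + t * (η - η₀)) (w' := fun _ => η - η₀) (α := α) (α' := α')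
      (fun t _ => by
        have h3 : HasDerivAt (fun t : ℝ => (t : ℂ)) 1 t := Complex.ofRealCLM.hasDerivAt
        simpa using (h3.mul_const (η - η₀)).const_add (η₀ : ℂ))
      (fun i t ht => (hα i t ht).1) (fun t ht => (hfacts t ht).2.1)
      (fun i t ht => (hfacts t ht).1 i) (fun t ht => (hfacts t ht).2.2.1)
      (fun t ht => by
        refine le_trans ?_ (mul_le_mul_of_nonneg_left (hfacts t ht).2.2.2.le hε0.le)
        rw [← mul_div_assoc, mul_add, Finset.mul_sum, ← mul_div_assoc]
        gcongr with i
        rw [norm_div, norm_div, norm_mul, norm_mul, ← mul_div_assoc]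
        gcongr ?_ / _
        have := (hα i t ht).2.1
        nlinarith [norm_nonneg (μ : ℂ)])
    have h1 := hfacts 1 ⟨zero_le_one, le_rfl⟩
    have hw1 : (η₀ : ℂ) + (1 : ℝ) * (η - η₀) = η := by push_cast; ring
    have hw0 : (η₀ : ℂ) + (0 : ℝ) * (η - η₀) = η₀ := by push_cast; ring
    simp only [hα1, hw1] at h1
    simp only [hα0, hα1, hw0, hw1] at hdist
    obtain ⟨h1a, h1b, h1c, -⟩ := h1
    have hne : η * ∏ i, (1 + (μ : ℂ) * a i) ≠ 0 :=
      mul_ne_zero h1b (Finset.prod_ne_zero_iff.2 fun i _ => h1a i)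
    have hne1 := Complex.slitPlane_ne_zero h1c
    have hF₀c : (η₀ : ℂ) * ∏ i, (1 + (μ : ℂ) * (p i : ℂ)) = (F₀ : ℂ) := by
      rw [hF₀def]
      push_cast
      rfl
    have hcl := hclosed p hp
    rw [← hF₀def] at hcl
    rw [hF₀c] at hdist
    generalize η * ∏ i, (1 + (μ : ℂ) * a i) = F at *
    have h2 : 1 + F = F * (1 + F⁻¹) := by field_simp; ring
    refine ⟨h1a, h2 ▸ mul_ne_zero hne hne1, Or.inr ⟨Complex.log (1 + F⁻¹),
      Real.log (1 + F₀⁻¹), Real.log_nonneg (by simpa using hF₀.le), ?_, ?_, ?_⟩⟩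
    · rw [Real.exp_neg, Real.exp_log (by positivity)]
      have : (1 + F₀⁻¹)⁻¹ = F₀ / (1 + F₀) := by field_simp; ring
      rw [this, div_le_iff₀ (by positivity)]
      exact hcl
    · rw [Complex.ofReal_log (by positivity)]
      simpa using hdist
    · rw [Complex.exp_neg, Complex.exp_log hne1, h2]
      field_simp
  refine ⟨Or.inl rfl, fun h => Or.inr ⟨0, 0, le_rfl, ?_, by simp, by simp⟩,
    fun a ha b hb => mul_mem_relNhds ha hb, fun a ha => ?_, fun a ha => (main a ha).2.1,
    fun a ha => (main a ha).2.2⟩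
  · rw [hpm1 fun h' => h (by simp [h'])]
    simp
  -- A single edge factor is read off from the constant family, which needs n ≥ 1.
  · exact (main (fun _ => a) fun _ => ha).1 ⟨0, hn⟩

/-! ### Reduction to equal hyperedge ratios -/

/-- The numerator of the derivative is −(1/p + μ) − μ(−log p), which is nonpositive because 0 ≤ −log
p ≤ 1/p − 1 and μ ≥ −1. -/
theorem antitoneOn_neg_log_div {μ : ℝ} (hμ : -1 ≤ μ) :
    AntitoneOn (fun p : ℝ => -Real.log p / (1 + μ * p)) (Set.Ioo 0 1) := by
  have hpos : ∀ p ∈ Set.Ioo (0 : ℝ) 1, 0 < 1 + μ * p := fun p hp => by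
    nlinarith [hp.1, hp.2]
  have hd : ∀ p ∈ Set.Ioo (0 : ℝ) 1, HasDerivAt (fun p : ℝ => -Real.log p / (1 + μ * p))
      ((-p⁻¹ * (1 + μ * p) - -Real.log p * μ) / (1 + μ * p) ^ 2) p := fun p hp => by
    have h1 : HasDerivAt (fun p => -Real.log p) (-p⁻¹) p := (Real.hasDerivAt_log hp.1.ne').neg
    have h2 : HasDerivAt (fun p => 1 + μ * p) μ p := by
      simpa using ((hasDerivAt_id p).const_mul μ).const_add 1
    exact h1.div h2 (hpos p hp).ne'
  refine antitoneOn_of_deriv_nonpos (convex_Ioo 0 1)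
    (fun p hp => (hd p hp).continuousAt.continuousWithinAt)
    (fun p hp => (hd p (interior_subset hp)).differentiableAt.differentiableWithinAt) ?_
  intro p hp
  have hp' := interior_subset hp
  rw [(hd p hp').deriv]
  refine div_nonpos_of_nonpos_of_nonneg ?_ (sq_nonneg _)
  have h1 : -Real.log p ≤ p⁻¹ - 1 := by
    rw [← Real.log_inv]
    exact Real.log_le_sub_one_of_pos (inv_pos.2 hp'.1)
  have h2 : 0 ≤ -Real.log p := by
    have := Real.log_nonpos hp'.1.le hp'.2.le
    linarith
  have h3 : p⁻¹ * (1 + μ * p) = p⁻¹ + μ := by field_simp [hp'.1.ne']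
  nlinarith

/-- Concavity, in the variable `ℓ = log (1 + μ p)`, of `|μ| p (-log p) / (1 + μ p)`. -/
theorem concaveOn_contraction {μ : ℝ} (hμ : -1 ≤ μ) (hμ0 : μ ≠ 0) {a b : ℝ}
    (hab : ∀ l ∈ Set.Icc a b, (Real.exp l - 1) / μ ∈ Set.Icc (0 : ℝ) 1) :
    ConcaveOn ℝ (Set.Icc a b)
      fun l => |μ| * Real.negMulLog ((Real.exp l - 1) / μ) * Real.exp (-l) := by
  have hab' : ∀ l ∈ Set.Ioo a b, (Real.exp l - 1) / μ ∈ Set.Ioo (0 : ℝ) 1 := by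
    intro l hl
    have ha := hab a ⟨le_rfl, (hl.1.trans hl.2).le⟩
    have hb := hab b ⟨(hl.1.trans hl.2).le, le_rfl⟩
    have h1 := Real.exp_lt_exp.2 hl.1
    have h2 := Real.exp_lt_exp.2 hl.2
    rcases lt_or_gt_of_ne hμ0 with h | h
    · have h3 : (Real.exp l - 1) / μ < (Real.exp a - 1) / μ :=
        div_lt_div_of_neg_of_lt h (by linarith)
      have h4 : (Real.exp b - 1) / μ < (Real.exp l - 1) / μ :=
        div_lt_div_of_neg_of_lt h (by linarith)
      exact ⟨hb.1.trans_lt h4, h3.trans_le ha.2⟩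
    · have h3 : (Real.exp a - 1) / μ < (Real.exp l - 1) / μ :=
        div_lt_div_of_pos_right (by linarith) h
      have h4 : (Real.exp l - 1) / μ < (Real.exp b - 1) / μ :=
        div_lt_div_of_pos_right (by linarith) h
      exact ⟨ha.1.trans_lt h3, h4.trans_le hb.2⟩
  have hcont : Continuous fun l => |μ| * Real.negMulLog ((Real.exp l - 1) / μ) * Real.exp (-l) := by
    have := Real.continuous_negMulLog
    fun_prop
  have hd : ∀ l ∈ Set.Ioo a b,
      HasDerivAt (fun l => |μ| * Real.negMulLog ((Real.exp l - 1) / μ) * Real.exp (-l))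
        (|μ| / μ * (-Real.log ((Real.exp l - 1) / μ) /
          (1 + μ * ((Real.exp l - 1) / μ)) - 1)) l := by
    intro l hl
    have hp := hab' l hl
    have h1 : HasDerivAt (fun l => (Real.exp l - 1) / μ) (Real.exp l / μ) l :=
      ((Real.hasDerivAt_exp l).sub_const 1).div_const μ
    have h2 := (Real.hasDerivAt_negMulLog hp.1.ne').comp l h1
    have h3 : HasDerivAt (fun l => Real.exp (-l)) (-Real.exp (-l)) l := by
      simpa using (hasDerivAt_id l).neg.exp
    refine ((h2.const_mul |μ|).mul h3).congr_deriv ?_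
    have h4 : 1 + μ * ((Real.exp l - 1) / μ) = Real.exp l := by field_simp; ring
    rw [h4, Function.comp_apply, Real.negMulLog, Real.exp_neg]
    have := (Real.exp_pos l).ne'
    field_simp
    ring
  -- The derivative is sign(μ)(−log p/(1 + μp) − 1). Since p increases with l for μ > 0 and
  -- decreases for μ < 0, it is antitone in l either way.
  refine AntitoneOn.concaveOn_of_deriv (convex_Icc a b) hcont.continuousOn ?_ ?_
  · rw [interior_Icc]
    exact fun l hl => (hd l hl).differentiableAt.differentiableWithinAt
  · rw [interior_Icc]
    intro l hl l' hl' hll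
    rw [(hd l hl).deriv, (hd l' hl').deriv]
    have he := Real.exp_le_exp.2 hll
    rcases lt_or_gt_of_ne hμ0 with h | h
    · have h3 : (Real.exp l' - 1) / μ ≤ (Real.exp l - 1) / μ :=
        div_le_div_of_nonpos_of_le h.le (by linarith)
      have h4 := antitoneOn_neg_log_div hμ (hab' l' hl') (hab' l hl) h3
      simp only at h4
      rw [abs_of_neg h, neg_div, div_self hμ0]
      linarith
    · have h3 : (Real.exp l - 1) / μ ≤ (Real.exp l' - 1) / μ :=
        div_le_div_of_nonneg_right (by linarith) h.le
      have h4 := antitoneOn_neg_log_div hμ (hab' l hl) (hab' l' hl') h3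
      simp only at h4
      rw [abs_of_pos h, div_self hμ0]
      linarith

/-- The contraction condition for several hyperedges follows from the one for equal hyperedges. -/
theorem contraction_of_univariate {n : ℕ} (hn : 1 ≤ n) {μ η₀ pm : ℝ} (hμ : -1 ≤ μ) (hpm : pm ≤ 1)
    (hpm0 : 0 ≤ pm) (hpos : ∀ p ∈ Set.Icc 0 pm, 0 < 1 + μ * p)
    (H : ∀ p ∈ Set.Icc 0 pm, n * (|μ| * Real.negMulLog p / (1 + μ * p)) <
      (1 + η₀ * (1 + μ * p) ^ n) * Real.log (1 + (η₀ * (1 + μ * p) ^ n)⁻¹))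
    (p : Fin n → ℝ) (hp : ∀ i, p i ∈ Set.Icc 0 pm) :
    ∑ i, |μ| * Real.negMulLog (p i) / (1 + μ * p i) <
      (1 + η₀ * ∏ i, (1 + μ * p i)) * Real.log (1 + (η₀ * ∏ i, (1 + μ * p i))⁻¹) := by
  rcases eq_or_ne μ 0 with rfl | hμ0
  · have := H 0 ⟨le_rfl, hpm0⟩
    simpa using this
  have hn0 : (n : ℝ) ≠ 0 := by positivity
  have hT : 0 < 1 + μ * pm := hpos pm ⟨hpm0, le_rfl⟩
  obtain ⟨a, b, hab⟩ : ∃ a b : ℝ, ∀ l, l ∈ Set.Icc a b ↔ (Real.exp l - 1) / μ ∈ Set.Icc 0 pm := by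
    rcases lt_or_gt_of_ne hμ0 with h | h
    · refine ⟨Real.log (1 + μ * pm), 0, fun l => ?_⟩
      rw [Set.mem_Icc, Set.mem_Icc, Real.log_le_iff_le_exp hT, le_div_iff_of_neg h,
        div_le_iff_of_neg h, ← Real.exp_le_one_iff]
      constructor <;> rintro ⟨h1, h2⟩ <;> constructor <;> linarith
    · refine ⟨0, Real.log (1 + μ * pm), fun l => ?_⟩
      rw [Set.mem_Icc, Set.mem_Icc, Real.le_log_iff_exp_le hT, le_div_iff₀ h, div_le_iff₀ h,
        ← Real.one_le_exp_iff]
      constructor <;> rintro ⟨h1, h2⟩ <;> constructor <;> linarith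
  have hconc := concaveOn_contraction hμ hμ0 (a := a) (b := b) fun l hl =>
    ⟨((hab l).1 hl).1, ((hab l).1 hl).2.trans hpm⟩
  have hexp : ∀ i, Real.exp (Real.log (1 + μ * p i)) = 1 + μ * p i := fun i =>
    Real.exp_log (hpos _ (hp i))
  have hinv : ∀ i, (Real.exp (Real.log (1 + μ * p i)) - 1) / μ = p i := fun i => by
    rw [hexp]
    field_simp
    ring
  have hmem : ∀ i ∈ (Finset.univ : Finset (Fin n)), Real.log (1 + μ * p i) ∈ Set.Icc a b :=
    fun i _ => (hab _).2 (by rw [hinv]; exact hp i)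
  have hw : ∑ _i : Fin n, (n : ℝ)⁻¹ = 1 := by simp [hn0]
  -- Replacing each log(1 + μpᵢ) by their mean preserves the product, hence the right side, and does
  -- not decrease the left side.
  have hJ := hconc.le_map_sum (t := Finset.univ) (w := fun _ => (n : ℝ)⁻¹)
    (fun _ _ => by positivity) hw hmem
  have hM := hconc.1.sum_mem (t := Finset.univ) (w := fun _ => (n : ℝ)⁻¹)
    (fun _ _ => by positivity) hw hmem
  simp only [smul_eq_mul] at hJ hM
  set l := ∑ i, (n : ℝ)⁻¹ * Real.log (1 + μ * p i) with hl
  have hU := H _ ((hab l).1 hM)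
  have hTl : 1 + μ * ((Real.exp l - 1) / μ) = Real.exp l := by field_simp; ring
  have hpow : Real.exp l ^ n = ∏ i, (1 + μ * p i) := by
    rw [← Real.exp_nat_mul, hl, ← Finset.mul_sum, ← mul_assoc, mul_inv_cancel₀ hn0, one_mul,
      Real.exp_sum]
    exact Finset.prod_congr rfl fun i _ => hexp i
  rw [hTl, hpow] at hU
  refine lt_of_le_of_lt ?_ hU
  have h1 : ∑ i, |μ| * Real.negMulLog (p i) / (1 + μ * p i) = n * ∑ i, (n : ℝ)⁻¹ *
      (|μ| * Real.negMulLog ((Real.exp (Real.log (1 + μ * p i)) - 1) / μ) *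
        Real.exp (-Real.log (1 + μ * p i))) := by
    rw [← Finset.mul_sum, ← mul_assoc, mul_inv_cancel₀ hn0, one_mul]
    refine Finset.sum_congr rfl fun i _ => ?_
    rw [hinv, Real.exp_neg, hexp, div_eq_mul_inv]
  rw [h1]
  refine mul_le_mul_of_nonneg_left ?_ (Nat.cast_nonneg n)
  refine hJ.trans (le_of_eq ?_)
  rw [Real.exp_neg, ← div_eq_mul_inv]

/-! ### The univariate inequality between `rate` and `growth` -/

namespace SetCover

/-- `h(y) = (1 + y) ln(1 + y) / y = (1 + y) ψ(y)`. -/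
noncomputable def growth (y : ℝ) : ℝ := (1 + y) * Real.log (1 + y) / y

/-- The contraction rate `n |μ| s e^{-s} / (1 + μ e^{-s})`. -/
noncomputable def rate (n : ℕ) (μ s : ℝ) : ℝ :=
  n * |μ| * s * Real.exp (-s) / (1 + μ * Real.exp (-s))

theorem growth_eq (y : ℝ) : growth y = (1 + y) * psi y := mul_div_assoc _ _ _

theorem psi_lt_one {y : ℝ} (hy : 0 < y) : psi y < 1 := by
  rw [psi, div_lt_one hy]
  have := Real.log_lt_sub_one_of_pos (by linarith : 0 < 1 + y) (by linarith)
  linarith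

theorem psi_pos {y : ℝ} (hy : 0 < y) : 0 < psi y := div_pos (Real.log_pos (by linarith)) hy

theorem one_lt_psi {y : ℝ} (hy : y < 0) (hy1 : -1 < y) : 1 < psi y := by
  rw [psi, lt_div_iff_of_neg hy]
  have := Real.log_lt_sub_one_of_pos (by linarith : 0 < 1 + y) (by linarith)
  linarith

theorem log_one_add_gt {y : ℝ} (hy : 0 < y) : y < (1 + y) * Real.log (1 + y) := by
  have h := Real.log_lt_sub_one_of_pos (inv_pos.2 (by linarith : 0 < 1 + y))
    fun h => by linarith [inv_eq_one.1 h]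
  rw [Real.log_inv] at h
  have h1 : (1 + y) * (1 + y)⁻¹ = 1 := mul_inv_cancel₀ (by positivity)
  nlinarith

theorem one_lt_growth {y : ℝ} (hy : 0 < y) : 1 < growth y := by
  rw [growth, lt_div_iff₀ hy, one_mul]
  exact log_one_add_gt hy

theorem growth_le {y : ℝ} (hy : 0 < y) : growth y ≤ 1 + y := by
  rw [growth_eq]
  nlinarith [psi_lt_one hy]

theorem log_le_growth {y : ℝ} (hy : 0 < y) : Real.log (1 + y) ≤ growth y := by
  rw [growth, le_div_iff₀ hy]
  have := Real.log_nonneg (by linarith : 1 ≤ 1 + y)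
  nlinarith

theorem hasDerivAt_log_one_add {y : ℝ} (hy : 0 < y) :
    HasDerivAt (fun y => Real.log (1 + y)) (1 + y)⁻¹ y := by
  simpa using ((hasDerivAt_id y).const_add 1).log (by simp only [id]; positivity)

theorem hasDerivAt_growth {y : ℝ} (hy : 0 < y) :
    HasDerivAt growth ((y - Real.log (1 + y)) / y ^ 2) y := by
  have h1 : HasDerivAt (fun y : ℝ => 1 + y) 1 y := (hasDerivAt_id y).const_add 1
  have h2 := (h1.mul (hasDerivAt_log_one_add hy)).div (hasDerivAt_id y) hy.ne'
  refine h2.congr_deriv ?_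
  simp only [id]
  have : 1 + y ≠ 0 := by positivity
  field_simp
  simp only [Pi.mul_apply]
  ring

theorem growth_strictMonoOn : StrictMonoOn growth (Set.Ioi 0) := by
  refine strictMonoOn_of_deriv_pos (convex_Ioi 0)
    (fun y hy => (hasDerivAt_growth hy).continuousAt.continuousWithinAt) fun y hy => ?_
  rw [interior_Ioi] at hy
  have hy : 0 < y := hy
  rw [(hasDerivAt_growth hy).deriv]
  have := Real.log_lt_sub_one_of_pos (by linarith : 0 < 1 + y) (by linarith)
  exact div_pos (by linarith) (by positivity)

theorem psi_strictAntiOn : StrictAntiOn psi (Set.Ioi 0) := by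
  have hd : ∀ y ∈ Set.Ioi (0 : ℝ),
      HasDerivAt psi (((1 + y)⁻¹ * y - Real.log (1 + y) * 1) / y ^ 2) y := fun y hy =>
    (hasDerivAt_log_one_add hy).div (hasDerivAt_id y) (ne_of_gt hy)
  refine strictAntiOn_of_deriv_neg (convex_Ioi 0)
    (fun y hy => (hd y hy).continuousAt.continuousWithinAt) fun y hy => ?_
  rw [interior_Ioi] at hy
  rw [(hd y hy).deriv]
  have hy : 0 < y := hy
  refine div_neg_of_neg_of_pos ?_ (by positivity)
  rw [mul_one, sub_neg, inv_mul_lt_iff₀ (by positivity)]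
  exact log_one_add_gt hy

theorem existsUnique_psi_eq {y c : ℝ} (hy : 0 < y) (h : psi y = c) :
    ∃! y : ℝ, 0 < y ∧ psi y = c :=
  ⟨y, ⟨hy, h⟩, fun _ hz => psi_strictAntiOn.injOn hz.1 hy (hz.2.trans h.symm)⟩

theorem psiInv_eq {y c : ℝ} (hy : 0 < y) (h : psi y = c) : psiInv c = y := by
  rw [← h]
  exact psi_strictAntiOn.injOn.leftInvOn_invFunOn hy

theorem one_add_mul_exp_pos {μ s : ℝ} (hμ : -1 ≤ μ) (hs : 0 < s) : 0 < 1 + μ * Real.exp (-s) := by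
  have h1 := Real.exp_pos (-s)
  have h2 : Real.exp (-s) < 1 := by
    rw [← Real.exp_zero]
    exact Real.exp_lt_exp.2 (by linarith)
  nlinarith

theorem rate_eq (n : ℕ) (μ s : ℝ) : rate n μ s = n * |μ| * s / (Real.exp s + μ) := by
  rw [rate, Real.exp_neg]
  have := (Real.exp_pos s).ne'
  have h : 1 + μ * (Real.exp s)⁻¹ = (Real.exp s + μ) / Real.exp s := by field_simp
  rw [h]
  field_simp

theorem exp_add_pos {μ s : ℝ} (hμ : -1 ≤ μ) (hs : 0 < s) : 0 < Real.exp s + μ := by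
  have := Real.one_lt_exp_iff.2 hs
  linarith

theorem hasDerivAt_one_add_mul_exp (μ s : ℝ) :
    HasDerivAt (fun s => 1 + μ * Real.exp (-s)) (-(μ * Real.exp (-s))) s := by
  have h3 : HasDerivAt (fun l => Real.exp (-l)) (-Real.exp (-s)) s := by
    simpa using (hasDerivAt_id s).neg.exp
  refine ((h3.const_mul μ).const_add 1).congr_deriv ?_
  ring

theorem hasDerivAt_rate (n : ℕ) {μ s : ℝ} (hμ : -1 ≤ μ) (hs : 0 < s) :
    HasDerivAt (rate n μ) (n * |μ| * Real.exp (-s) * (1 + μ * Real.exp (-s) - s) /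
      (1 + μ * Real.exp (-s)) ^ 2) s := by
  have h3 : HasDerivAt (fun l => Real.exp (-l)) (-Real.exp (-s)) s := by
    simpa using (hasDerivAt_id s).neg.exp
  have h4 := (((hasDerivAt_id s).const_mul (n * |μ|)).mul h3).div (hasDerivAt_one_add_mul_exp μ s)
    (one_add_mul_exp_pos hμ hs).ne'
  refine h4.congr_deriv ?_
  simp only [id, Pi.mul_apply]
  congr 1
  ring

/-- Outside a compact interval of `s` the contraction condition is automatic. -/
theorem exists_cutoff {n : ℕ} (hn : 1 ≤ n) {μ : ℝ} (hμ : -1 ≤ μ) (hμ0 : μ ≠ 0) {c : ℝ}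
    (hc : 0 < c) : ∃ s₀ S : ℝ, 0 < s₀ ∧ ∀ s, 0 < s → s ∉ Set.Icc s₀ S → ∀ C, c ≤ C →
      rate n μ s < growth (C / (1 + μ * Real.exp (-s)) ^ n) := by
  have hn0 : (0 : ℝ) < n := by exact_mod_cast hn
  have hμa : 0 < |μ| := abs_pos.2 hμ0
  have hy : ∀ s, 0 < s → ∀ C, c ≤ C → 0 < C / (1 + μ * Real.exp (-s)) ^ n := fun s hs C hC =>
    div_pos (hc.trans_le hC) (pow_pos (one_add_mul_exp_pos hμ hs) n)
  have hS : ∀ s, 2 * n * |μ| < s → ∀ C, c ≤ C →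
      rate n μ s < growth (C / (1 + μ * Real.exp (-s)) ^ n) := fun s hs C hC => by
    have hs0 : 0 < s := lt_trans (by positivity) hs
    refine lt_of_le_of_lt ?_ (one_lt_growth (hy s hs0 C hC))
    rw [rate_eq, div_le_one (exp_add_pos hμ hs0)]
    have := Real.quadratic_le_exp_of_nonneg hs0.le
    nlinarith
  -- As s → 0 the rate tends to 0 if μ > −1, but to n if μ = −1; there 1 − e^{-s} ≤ s makes y large
  -- enough that log(1 + y) > n.
  rcases eq_or_lt_of_le hμ with rfl | hμ1
  · refine ⟨min 1 (c / Real.exp n), 2 * n * |(-1 : ℝ)|, by positivity, fun s hs hs' C hC => ?_⟩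
    rcases lt_or_ge (2 * n * |(-1 : ℝ)|) s with h | h
    · exact hS s h C hC
    have hs1 : s < min 1 (c / Real.exp n) := by
      by_contra h1
      exact hs' ⟨not_lt.1 h1, h⟩
    have h1 : s < 1 := hs1.trans_le (min_le_left _ _)
    have h2 : s < c / Real.exp n := hs1.trans_le (min_le_right _ _)
    have hT := one_add_mul_exp_pos le_rfl hs
    have hTs : 1 + -1 * Real.exp (-s) ≤ s := by linarith [Real.add_one_le_exp (-s)]
    have hTn : (1 + -1 * Real.exp (-s)) ^ n ≤ s := by
      refine (pow_le_pow_of_le_one hT.le (by linarith) hn).trans ?_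
      rwa [pow_one]
    have h3 : Real.exp n < C / (1 + -1 * Real.exp (-s)) ^ n := by
      rw [lt_div_iff₀ (pow_pos hT n)]
      rw [lt_div_iff₀ (Real.exp_pos _)] at h2
      nlinarith [Real.exp_pos n]
    have h4 : (n : ℝ) < Real.log (1 + C / (1 + -1 * Real.exp (-s)) ^ n) := by
      rw [Real.lt_log_iff_exp_lt (by linarith [hy s hs C hC])]
      linarith
    refine lt_of_le_of_lt ?_ (h4.trans_le (log_le_growth (hy s hs C hC)))
    rw [rate_eq, div_le_iff₀ (exp_add_pos le_rfl hs)]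
    simp only [abs_neg, abs_one, mul_one]
    nlinarith [Real.add_one_le_exp s]
  · refine ⟨(1 + μ) / (n * |μ|), 2 * n * |μ|, div_pos (by linarith) (by positivity),
      fun s hs hs' C hC => ?_⟩
    rcases lt_or_ge (2 * n * |μ|) s with h | h
    · exact hS s h C hC
    have hs1 : s < (1 + μ) / (n * |μ|) := by
      by_contra h1
      exact hs' ⟨not_lt.1 h1, h⟩
    refine lt_of_le_of_lt ?_ (one_lt_growth (hy s hs C hC))
    rw [rate_eq, div_le_one (exp_add_pos hμ hs)]
    rw [lt_div_iff₀ (by positivity)] at hs1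
    linarith [Real.add_one_le_exp s]

/-! ### The extremal activity -/

/-- The extremal `C = 1 / η` for which the contraction rate reaches `1`, and the equation that the
point `s` where this happens satisfies. -/
theorem exists_extremal {n : ℕ} (hn : 1 ≤ n) {μ : ℝ} (hμ : -1 ≤ μ) (hμ0 : μ ≠ 0)
    (h1 : ∃ s, 0 < s ∧ 1 < rate n μ s) :
    ∃ s y : ℝ, 0 < s ∧ 0 < y ∧ rate n μ s = growth y ∧
      |μ| * (1 + μ * Real.exp (-s) - s) = μ * ((1 + μ * Real.exp (-s)) * (1 - psi y)) ∧
      ∀ C, y * (1 + μ * Real.exp (-s)) ^ n < C → ∀ s', 0 < s' →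
        rate n μ s' < growth (C / (1 + μ * Real.exp (-s')) ^ n) := by
  obtain ⟨s₁, hs₁, hr₁⟩ := h1
  have hn0 : (0 : ℝ) < n := by exact_mod_cast hn
  have hT : ∀ s, 0 < s → 0 < (1 + μ * Real.exp (-s)) ^ n := fun s hs =>
    pow_pos (one_add_mul_exp_pos hμ hs) n
  -- This c gives y = rate − 1 at s₁, and `growth y` ≤ 1 + y shows that the strict inequality fails
  -- for (s₁, c). Larger C therefore suffice to consider, and they stay away from 0.
  set c := (rate n μ s₁ - 1) * (1 + μ * Real.exp (-s₁)) ^ n with hcdef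
  have hc : 0 < c := mul_pos (by linarith) (hT s₁ hs₁)
  obtain ⟨s₀, S, hs₀, hcut⟩ := exists_cutoff hn hμ hμ0 hc
  have hrc : ContinuousOn (rate n μ) (Set.Icc s₀ S) := fun s hs =>
    (hasDerivAt_rate n hμ (hs₀.trans_le hs.1)).continuousAt.continuousWithinAt
  obtain ⟨M, hM⟩ := (isCompact_Icc.image_of_continuousOn hrc).bddAbove
  have hgc : ∀ s C, 0 < s → 0 < C → ContinuousAt
      (fun z : ℝ × ℝ => growth (z.2 / (1 + μ * Real.exp (-z.1)) ^ n)) (s, C) := fun s C hs hC => by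
    refine ContinuousAt.comp (g := growth)
      (hasDerivAt_growth (div_pos hC (hT s hs))).continuousAt ?_
    refine ContinuousAt.div continuousAt_snd ?_ (hT s hs).ne'
    exact Continuous.continuousAt (by fun_prop)
  set C₁ := Real.exp M * (1 + |μ|) ^ n with hC₁
  have hbound : ∀ s C, 0 < s → c ≤ C → growth (C / (1 + μ * Real.exp (-s)) ^ n) ≤ rate n μ s →
      s ∈ Set.Icc s₀ S ∧ C ∈ Set.Icc c C₁ := by
    intro s C hs hC hle
    have hsI : s ∈ Set.Icc s₀ S := by
      by_contra h
      exact absurd (hcut s hs h C hC) (not_lt.2 hle)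
    refine ⟨hsI, hC, ?_⟩
    have hy : 0 < C / (1 + μ * Real.exp (-s)) ^ n := div_pos (hc.trans_le hC) (hT s hs)
    have h2 : Real.log (1 + C / (1 + μ * Real.exp (-s)) ^ n) ≤ M :=
      (log_le_growth hy).trans (hle.trans (hM ⟨s, hsI, rfl⟩))
    rw [Real.log_le_iff_le_exp (by positivity)] at h2
    have h3 : C / (1 + μ * Real.exp (-s)) ^ n ≤ Real.exp M := by linarith
    rw [div_le_iff₀ (hT s hs)] at h3
    refine h3.trans ?_
    rw [hC₁]
    have h4 : μ * Real.exp (-s) ≤ |μ| := by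
      have : Real.exp (-s) ≤ 1 := Real.exp_le_one_iff.2 (by linarith)
      exact (mul_le_mul_of_nonneg_right (le_abs_self μ) (Real.exp_pos _).le).trans
        (mul_le_of_le_one_right (abs_nonneg μ) this)
    have := one_add_mul_exp_pos hμ hs
    gcongr
  have hcont : ContinuousOn
      (fun z : ℝ × ℝ => rate n μ z.1 - growth (z.2 / (1 + μ * Real.exp (-z.1)) ^ n))
      (Set.Icc s₀ S ×ˢ Set.Icc c C₁) := by
    intro z hz
    refine ContinuousAt.continuousWithinAt (ContinuousAt.sub ?_ ?_)
    · exact ContinuousAt.comp (g := rate n μ)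
        (hasDerivAt_rate n hμ (hs₀.trans_le hz.1.1)).continuousAt continuousAt_fst
    · exact hgc z.1 z.2 (hs₀.trans_le hz.1.1) (hc.trans_le hz.2.1)
  set K := (Set.Icc s₀ S ×ˢ Set.Icc c C₁) ∩
    (fun z : ℝ × ℝ => rate n μ z.1 - growth (z.2 / (1 + μ * Real.exp (-z.1)) ^ n)) ⁻¹' Set.Ici 0
    with hK
  have hKc : IsCompact K := (isCompact_Icc.prod isCompact_Icc).of_isClosed_subset
    (hcont.preimage_isClosed_of_isClosed (isClosed_Icc.prod isClosed_Icc) isClosed_Ici)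
    Set.inter_subset_left
  have hKmem : ∀ s C, 0 < s → c ≤ C → growth (C / (1 + μ * Real.exp (-s)) ^ n) ≤ rate n μ s →
      (s, C) ∈ K := fun s C hs hC h => ⟨hbound s C hs hC h, sub_nonneg.2 h⟩
  have hKne : K.Nonempty := by
    refine ⟨(s₁, c), hKmem s₁ c hs₁ le_rfl ?_⟩
    have hq : c / (1 + μ * Real.exp (-s₁)) ^ n = rate n μ s₁ - 1 := by
      rw [hcdef, mul_div_assoc, div_self (hT s₁ hs₁).ne', mul_one]
    rw [hq]
    linarith [growth_le (by linarith : 0 < rate n μ s₁ - 1)]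
  -- K is the compact set of failing pairs with C ≥ c; a pair with maximal C is extremal.
  obtain ⟨⟨s, C⟩, hzK, hmax⟩ := hKc.exists_isMaxOn hKne continuous_snd.continuousOn
  have hs : 0 < s := hs₀.trans_le hzK.1.1.1
  have hcC : c ≤ C := hzK.1.2.1
  have hC : 0 < C := hc.trans_le hcC
  have habove : ∀ C', C < C' → ∀ s', 0 < s' →
      rate n μ s' < growth (C' / (1 + μ * Real.exp (-s')) ^ n) := by
    intro C' hC' s' hs'
    by_contra h
    have := hmax (hKmem s' C' hs' (hcC.trans hC'.le) (not_lt.1 h))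
    exact absurd this (not_le.2 hC')
  have hat : ∀ s', 0 < s' → rate n μ s' ≤ growth (C / (1 + μ * Real.exp (-s')) ^ n) := by
    intro s' hs'
    have hcc : ContinuousAt (fun C => growth (C / (1 + μ * Real.exp (-s')) ^ n)) C :=
      ContinuousAt.comp (f := fun C : ℝ => (s', C))
        (g := fun z : ℝ × ℝ => growth (z.2 / (1 + μ * Real.exp (-z.1)) ^ n))
        (hgc s' C hs' hC) (by fun_prop)
    refine ge_of_tendsto (hcc.tendsto.mono_left nhdsWithin_le_nhds : Filter.Tendsto _
      (nhdsWithin C (Set.Ioi C)) _) ?_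
    filter_upwards [self_mem_nhdsWithin] with C' hC' using (habove C' hC' s' hs').le
  have hle : growth (C / (1 + μ * Real.exp (-s)) ^ n) ≤ rate n μ s := sub_nonneg.1 hzK.2
  have heq := le_antisymm (hat s hs) hle
  set y := C / (1 + μ * Real.exp (-s)) ^ n with hy
  have hy0 : 0 < y := div_pos hC (hT s hs)
  have hyC : y * (1 + μ * Real.exp (-s)) ^ n = C := div_mul_cancel₀ _ (hT s hs).ne'
  refine ⟨s, y, hs, hy0, heq, ?_, by rwa [hyC]⟩
  have hT1 := one_add_mul_exp_pos hμ hs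
  have hdy : HasDerivAt (fun s => C / (1 + μ * Real.exp (-s)) ^ n)
      (n * (μ * Real.exp (-s)) * y / (1 + μ * Real.exp (-s))) s := by
    have h2 := ((hasDerivAt_one_add_mul_exp μ s).pow n).inv (hT s hs).ne'
    refine (h2.const_mul C).congr_deriv ?_
    obtain ⟨k, rfl⟩ : ∃ k, n = k + 1 := ⟨n - 1, by omega⟩
    rw [hy]
    simp only [Pi.pow_apply, Nat.add_sub_cancel]
    generalize 1 + μ * Real.exp (-s) = T at *
    field_simp
    ring
  -- At the maximal C the difference is nonpositive for every s' > 0, by letting C' decrease to C,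
  -- and vanishes at s. The critical-point equation is thus available.
  have hlocal : IsLocalMax (fun s => rate n μ s - growth (C / (1 + μ * Real.exp (-s)) ^ n)) s := by
    filter_upwards [lt_mem_nhds hs] with s' hs'
    have := hat s' hs'
    linarith
  have hg : HasDerivAt growth ((y - Real.log (1 + y)) / y ^ 2)
    (C / (1 + μ * Real.exp (-s)) ^ n) := hasDerivAt_growth hy0
  have hgy := HasDerivAt.comp (h₂ := growth) (h := fun s => C / (1 + μ * Real.exp (-s)) ^ n) s
    hg hdy
  have hD := hlocal.hasDerivAt_eq_zero ((hasDerivAt_rate n hμ hs).sub hgy)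
  have he := Real.exp_pos (-s)
  rw [psi]
  generalize 1 + μ * Real.exp (-s) = T at *
  generalize Real.exp (-s) = E at *
  field_simp at hD ⊢
  rw [mul_zero] at hD
  have := (mul_eq_zero.1 hD).resolve_left (by positivity)
  linarith
-- Identification of the thresholds
-- Bound e^x below by its tangent at s: then s(μ + e^x) − x(μ + e^s) is at least (x − s)(s e^s − μ −
-- e^s). It compares values of the function whose multiple is `rate` on one side of its maximum.
theorem div_lt_div_of_tangent {μ s x : ℝ} (hs : 0 < s) (h1 : 0 < μ + Real.exp x)
    (h2 : 0 < μ + Real.exp s) (h : 0 < (x - s) * (s * Real.exp s - μ - Real.exp s)) :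
    x / (μ + Real.exp x) < s / (μ + Real.exp s) := by
  rw [div_lt_div_iff₀ h1 h2]
  have h3 : Real.exp s * (1 + x - s) ≤ Real.exp x := by
    have h4 := Real.add_one_le_exp (x - s)
    have h5 : Real.exp x = Real.exp s * Real.exp (x - s) := by rw [← Real.exp_add]; congr 1; ring
    rw [h5]
    exact mul_le_mul_of_nonneg_left (by linarith) (Real.exp_pos _).le
  nlinarith

/-- At s = log(nμ) the rate is s/(1 + 1/n), which exceeds 1 precisely when μ > μ₁. -/
theorem exists_one_lt_rate_of_mu1_lt {n : ℕ} (hn : 1 ≤ n) {μ : ℝ} (h : mu1 (n + 1) < μ) :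
    0 < μ ∧ ∃ s, 0 < s ∧ 1 < rate n μ s := by
  have hn0 : (0 : ℝ) < n := by exact_mod_cast hn
  rw [mu1] at h
  push_cast at h
  rw [add_sub_cancel_right] at h
  have hμ : 0 < μ := lt_trans (by positivity) h
  rw [div_lt_iff₀ hn0, mul_comm, ← Real.lt_log_iff_exp_lt (by positivity)] at h
  have hpos : 0 < Real.log (n * μ) := lt_trans (by positivity) h
  refine ⟨hμ, _, hpos, ?_⟩
  rw [rate_eq, abs_of_pos hμ, Real.exp_log (by positivity), lt_div_iff₀ (by positivity)]
  have h1 : (1 + 1 / (n : ℝ)) * (n * μ) = n * μ + μ := by field_simp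
  have := mul_lt_mul_of_pos_right h (by positivity : 0 < n * μ)
  linarith

/-- At s = log(n|μ|), rate > 1 reads (1 − 1/n) n|μ| < n|μ| s, that is, μ < μ₂. -/
theorem exists_one_lt_rate_of_lt_mu2 {n : ℕ} (hn : 1 ≤ n) {μ : ℝ} (hμ : -1 ≤ μ)
    (h : μ < mu2 (n + 1)) : μ < 0 ∧ ∃ s, 0 < s ∧ 1 < rate n μ s := by
  have hn0 : (0 : ℝ) < n := by exact_mod_cast hn
  have hn1 : (1 : ℝ) ≤ n := by exact_mod_cast hn
  rw [mu2] at h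
  push_cast at h
  rw [add_sub_cancel_right, lt_neg] at h
  have hμ0 : 0 < -μ := lt_trans (by positivity) h
  rw [div_lt_iff₀ hn0, mul_comm, ← Real.lt_log_iff_exp_lt (by positivity)] at h
  have h2 : 1 / (n : ℝ) ≤ 1 := by rw [div_le_one hn0]; exact hn1
  have hpos : 0 < Real.log (n * -μ) := lt_of_le_of_lt (by linarith) h
  refine ⟨by linarith, _, hpos, ?_⟩
  have hexp := exp_add_pos hμ hpos
  rw [rate_eq, abs_of_neg (by linarith), lt_div_iff₀ hexp, Real.exp_log (by positivity)]
  have h1 : (1 - 1 / (n : ℝ)) * (n * -μ) = n * -μ + μ := by field_simp; ring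
  have := mul_lt_mul_of_pos_right h (by positivity : 0 < n * -μ)
  linarith

/-- Bounding e^s by its tangent at log(n|μ|) leaves n|μ|(1 − log(n|μ|)) + μ ≥ 0, which is what the
bounds μ₂ and μ₁ encode for the two signs of μ. -/
theorem rate_le_one {n : ℕ} (hn : 1 ≤ n) {μ s : ℝ} (hμ : -1 ≤ μ)
    (h : μ ∈ Set.Icc (mu2 (n + 1)) (mu1 (n + 1))) (hs : 0 < s) : rate n μ s ≤ 1 := by
  have hn0 : (0 : ℝ) < n := by exact_mod_cast hn
  rcases eq_or_ne μ 0 with rfl | hμ0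
  · simp [rate]
  have hμa : 0 < n * |μ| := mul_pos hn0 (abs_pos.2 hμ0)
  rw [rate_eq, div_le_one (exp_add_pos hμ hs)]
  have h1 : n * |μ| * (1 + s - Real.log (n * |μ|)) ≤ Real.exp s := by
    have h4 := Real.add_one_le_exp (s - Real.log (n * |μ|))
    rw [Real.exp_sub, Real.exp_log hμa, le_div_iff₀ hμa] at h4
    linarith
  have h2 : 0 ≤ n * |μ| * (1 - Real.log (n * |μ|)) + μ := by
    rw [mu1, mu2] at h
    push_cast at h
    rw [add_sub_cancel_right] at h
    rcases lt_or_gt_of_ne hμ0 with hneg | hpos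
    · have h3 := h.1
      rw [neg_le, ← abs_of_neg hneg, le_div_iff₀ hn0, mul_comm, ← Real.log_le_iff_le_exp hμa] at h3
      have h5 : n * |μ| * (1 / (n : ℝ)) = -μ := by
        rw [abs_of_neg hneg]; field_simp
      nlinarith
    · have h3 := h.2
      have h6 : |μ| = μ := abs_of_pos hpos
      rw [← h6, le_div_iff₀ hn0, mul_comm, ← Real.log_le_iff_le_exp hμa] at h3
      have h5 : n * |μ| * (1 / (n : ℝ)) = μ := by
        rw [h6]; field_simp
      nlinarith
  nlinarith

/-- For μ > 0 the tangency equation is ψ(y) = s/(1 + μe^{-s}). With rate = (1 + y)ψ(y) it gives 1 +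
y = nμe^{-s}, and taking logarithms yields the equation for x₁. -/
theorem exists_threshold_of_mu1_lt {n : ℕ} (hn : 1 ≤ n) {μ : ℝ} (h : mu1 (n + 1) < μ) :
    ∃ s y : ℝ, 0 < s ∧ 0 < y ∧ IsLeast (solutions1 (n + 1) μ) s ∧
      psi y = s / (1 + μ * Real.exp (-s)) ∧
      ∀ C, y * (1 + μ * Real.exp (-s)) ^ n < C → ∀ s', 0 < s' →
        rate n μ s' < growth (C / (1 + μ * Real.exp (-s')) ^ n) := by
  have hn0 : (0 : ℝ) < n := by exact_mod_cast hn
  obtain ⟨hμ, hr⟩ := exists_one_lt_rate_of_mu1_lt hn h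
  obtain ⟨s, y, hs, hy, hrate, hcrit, hmax⟩ := exists_extremal hn (by linarith) hμ.ne' hr
  have hT : 0 < 1 + μ * Real.exp (-s) := by positivity
  have hpsi : psi y = s / (1 + μ * Real.exp (-s)) := by
    rw [abs_of_pos hμ] at hcrit
    have := mul_left_cancel₀ hμ.ne' hcrit
    rw [eq_div_iff hT.ne']
    linarith
  have hsol : s ∈ solutions1 (n + 1) μ := by
    have h1 : n * μ * Real.exp (-s) = 1 + y := by
      rw [rate, growth_eq, hpsi, abs_of_pos hμ, ← mul_div_assoc,
        div_left_inj' hT.ne'] at hrate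
      have := hs.ne'
      apply mul_right_cancel₀ this
      linarith
    have h2 : Real.log (1 + y) = Real.log (n * μ) - s := by
      rw [← h1, Real.log_mul (by positivity) (by positivity), Real.log_exp]
      ring
    rw [psi, h2, div_eq_div_iff hy.ne' hT.ne'] at hpsi
    have hE : Real.exp s = (Real.exp (-s))⁻¹ := by rw [Real.exp_neg, inv_inv]
    rw [solutions1, Set.mem_ofPred_eq]
    push_cast
    rw [add_sub_cancel_right, hE]
    have he := Real.exp_pos (-s)
    generalize Real.exp (-s) = E at *
    have h3 : μ + E⁻¹ = (1 + μ * E) / E := by field_simp; ring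
    rw [h3, div_div_eq_mul_div, div_eq_div_iff hT.ne' (by positivity)]
    have h4 : y = n * μ * E - 1 := by linarith
    rw [h4] at hpsi
    linarith
  refine ⟨s, y, hs, hy, ⟨hsol, fun x hx => ?_⟩, hpsi, hmax⟩
  by_contra hlt
  rw [not_le] at hlt
  rw [solutions1, Set.mem_ofPred_eq] at hx hsol
  -- ψ(y) < 1 puts s on the increasing side of x/(μ + e^x), so no smaller x attains the same value.
  have hsT : s < 1 + μ * Real.exp (-s) := by
    have := psi_lt_one hy
    rwa [hpsi, div_lt_one hT] at this
  have h5 : s * Real.exp s - μ - Real.exp s < 0 := by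
    have h6 := mul_lt_mul_of_pos_right hsT (Real.exp_pos s)
    have h7 : Real.exp (-s) * Real.exp s = 1 := by rw [← Real.exp_add]; simp
    nlinarith
  have h8 := div_lt_div_of_tangent (x := x) hs (by positivity) (by positivity)
    (mul_pos_of_neg_of_neg (by linarith) h5)
  rw [← hsol, mul_div_assoc, mul_div_assoc] at hx
  exact h8.ne (mul_left_cancel₀ hμ.ne' hx)

/-- For μ < 0 the tangency equation is ψ(y) = 2 − s/(1 + μe^{-s}), and rate = (1 + y)ψ(y) makes the
logarithm's argument 1 + y. A solution x > s would come with a larger y by monotonicity of ψ, hence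
a larger rate, although the rate is smaller beyond s. -/
theorem exists_threshold_of_lt_mu2 {n : ℕ} (hn : 1 ≤ n) {μ : ℝ} (hμ : -1 ≤ μ)
    (h : μ < mu2 (n + 1)) :
    ∃ s y : ℝ, 0 < s ∧ 0 < y ∧ IsGreatest (solutions2 (n + 1) μ) s ∧
      psi y = 2 - s / (1 + μ * Real.exp (-s)) ∧
      ∀ C, y * (1 + μ * Real.exp (-s)) ^ n < C → ∀ s', 0 < s' →
        rate n μ s' < growth (C / (1 + μ * Real.exp (-s')) ^ n) := by
  have hn0 : (0 : ℝ) < n := by exact_mod_cast hn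
  obtain ⟨hneg, hr⟩ := exists_one_lt_rate_of_lt_mu2 hn hμ h
  obtain ⟨s, y, hs, hy, hrate, hcrit, hmax⟩ := exists_extremal hn hμ hneg.ne hr
  have hT := one_add_mul_exp_pos hμ hs
  have hpsiT : psi y * (1 + μ * Real.exp (-s)) = 2 * (1 + μ * Real.exp (-s)) - s := by
    rw [abs_of_neg hneg, neg_mul_comm] at hcrit
    have := mul_left_cancel₀ hneg.ne hcrit
    linarith
  have hpsi : psi y = 2 - s / (1 + μ * Real.exp (-s)) := by
    field_simp
    linarith
  have hratex : ∀ x, 0 < x → -(n * x * μ * Real.exp (-x)) =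
      rate n μ x * (1 + μ * Real.exp (-x)) := fun x hx => by
    rw [rate, div_mul_cancel₀ _ (one_add_mul_exp_pos hμ hx).ne', abs_of_neg hneg]
    ring
  have hpsi0 := psi_pos hy
  have hpsi1 := psi_lt_one hy
  have hlog : psi y * y = Real.log (1 + y) := div_mul_cancel₀ _ hy.ne'
  have hlog0 : 0 < Real.log (1 + y) := Real.log_pos (by linarith)
  refine ⟨s, y, hs, hy, ⟨?_, fun x hx => ?_⟩, hpsi, hmax⟩
  · have h1 : logArg2 (n + 1) μ s = 1 + y := by
      rw [logArg2]
      push_cast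
      rw [add_sub_cancel_right, hratex s hs, hrate, growth_eq]
      have h2 : 2 - s + 2 * μ * Real.exp (-s) = psi y * (1 + μ * Real.exp (-s)) := by linarith
      rw [h2]
      field_simp
    refine ⟨by rw [h1]; linarith, ?_⟩
    rw [h1]
    push_cast
    have h3 := hratex s hs
    rw [hrate, growth_eq] at h3
    have h2 : s - 2 - 2 * μ * Real.exp (-s) - ((n : ℝ) + 1 - 1) * s * μ * Real.exp (-s) =
        Real.log (1 + y) * (1 + μ * Real.exp (-s)) := by
      rw [← hlog]
      linarith
    rw [h2]
    field_simp
  · by_contra hlt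
    rw [not_le] at hlt
    have hx0 : 0 < x := hs.trans hlt
    have hT' := one_add_mul_exp_pos hμ hx0
    obtain ⟨hq, heq⟩ := hx
    have hqdef : logArg2 (n + 1) μ x =
        -(n * x * μ * Real.exp (-x)) / (2 - x + 2 * μ * Real.exp (-x)) := by
      rw [logArg2]
      push_cast
      rw [add_sub_cancel_right]
    have hnum : 0 < -(n * x * μ * Real.exp (-x)) := by
      have : 0 < n * x * (-μ) * Real.exp (-x) := by
        have : 0 < -μ := by linarith
        positivity
      linarith
    have hD : 0 < 2 - x + 2 * μ * Real.exp (-x) := by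
      rw [hqdef] at hq
      exact (div_pos_iff_of_pos_left hnum).1 hq
    generalize logArg2 (n + 1) μ x = q at hq heq hqdef
    rw [eq_div_iff hD.ne'] at hqdef
    have hden : x - 2 - 2 * μ * Real.exp (-x) - (((n + 1 : ℕ) : ℝ) - 1) * x * μ * Real.exp (-x) =
        (2 - x + 2 * μ * Real.exp (-x)) * (q - 1) := by
      push_cast
      linarith
    rw [hden] at heq
    -- If q = 1 the denominator vanishes, and the convention for division by zero turns the equation
    -- into 0 = 1.
    have hq1 : q - 1 ≠ 0 := by
      intro h0
      rw [h0] at heq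
      simp at heq
    have hpsi' : psi (q - 1) = 2 - x / (1 + μ * Real.exp (-x)) := by
      rw [psi, add_sub_cancel]
      rw [← mul_div_assoc, div_eq_one_iff_eq (mul_ne_zero hD.ne' hq1)] at heq
      have h3 : 2 - x / (1 + μ * Real.exp (-x)) =
          (2 - x + 2 * μ * Real.exp (-x)) / (1 + μ * Real.exp (-x)) := by
        rw [eq_div_iff hT'.ne', sub_mul, div_mul_cancel₀ _ hT'.ne']
        ring
      rw [h3, div_eq_iff hq1, div_mul_eq_mul_div, eq_div_iff hT'.ne']
      exact heq
    have hgrow' : growth (q - 1) = rate n μ x := by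
      rw [growth_eq, hpsi', add_sub_cancel]
      have h3 := hratex x hx0
      rw [← hqdef] at h3
      field_simp
      linarith
    have hmono : s / (1 + μ * Real.exp (-s)) < x / (1 + μ * Real.exp (-x)) := by
      rw [div_lt_div_iff₀ hT hT']
      have h3 : Real.exp (-s) * (1 - (x - s)) ≤ Real.exp (-x) := by
        have h4 := Real.add_one_le_exp (-(x - s))
        have h5 : Real.exp (-x) = Real.exp (-s) * Real.exp (-(x - s)) := by
          rw [← Real.exp_add]; congr 1; ring
        rw [h5]
        exact mul_le_mul_of_nonneg_left (by linarith) (Real.exp_pos _).le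
      have h6 : Real.exp (-s) * (1 + s) < 1 := by
        have h7 := Real.add_one_lt_exp hs.ne'
        have h8 : Real.exp (-s) * Real.exp s = 1 := by rw [← Real.exp_add]; simp
        nlinarith [Real.exp_pos (-s)]
      have h9 : x * Real.exp (-s) - s * Real.exp (-x) < x - s := by
        have h10 := mul_le_mul_of_nonneg_left h3 hs.le
        have h11 := mul_lt_mul_of_pos_left h6 (sub_pos.2 hlt)
        linarith
      rcases le_or_gt 0 (x * Real.exp (-s) - s * Real.exp (-x)) with h10 | h10
      · have := mul_nonneg (by linarith : 0 ≤ 1 + μ) h10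
        linarith
      · have := mul_pos_of_neg_of_neg hneg h10
        linarith
    have hpsilt : psi (q - 1) < psi y := by
      rw [hpsi, hpsi']
      linarith
    -- On (−1, 0) the function ψ exceeds 1, while here ψ(q − 1) < ψ(y) < 1.
    have hq0 : 0 < q - 1 := by
      by_contra h0
      have := one_lt_psi (lt_of_le_of_ne (not_lt.1 h0) hq1) (by linarith)
      linarith
    have hyq : y < q - 1 := by
      by_contra h0
      have := psi_strictAntiOn.antitoneOn hq0 hy (not_lt.1 h0)
      linarith
    have hgrow := growth_strictMonoOn hy hq0 hyq
    rw [hgrow', ← hrate, rate_eq, rate_eq, mul_div_assoc, mul_div_assoc] at hgrow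
    have hsT : 1 + μ * Real.exp (-s) < s := by
      have h3 : 1 < s / (1 + μ * Real.exp (-s)) := by linarith
      rwa [one_lt_div hT] at h3
    have h5 : 0 < s * Real.exp s - μ - Real.exp s := by
      have h6 := mul_lt_mul_of_pos_right hsT (Real.exp_pos s)
      have h7 : Real.exp (-s) * Real.exp s = 1 := by rw [← Real.exp_add]; simp
      nlinarith
    have h8 := div_lt_div_of_tangent (x := x) hs (by linarith [exp_add_pos hμ hx0])
      (by linarith [exp_add_pos hμ hs]) (mul_pos (by linarith) h5)
    rw [add_comm μ, add_comm μ] at h8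
    have h9 : 0 < n * |μ| := mul_pos hn0 (abs_pos.2 hneg.ne)
    exact absurd hgrow (not_lt.2 (mul_le_mul_of_nonneg_left h8.le h9.le))

/-! ### Assembly -/

theorem exists_stableSet {n : ℕ} (hn : 1 ≤ n) {μ η₀ : ℝ} (hμ : -1 ≤ μ) (hη₀ : 0 < η₀)
    (H : ∀ s, 0 < s → rate n μ s < growth (η₀⁻¹ / (1 + μ * Real.exp (-s)) ^ n)) :
    ∃ δ : ℝ, 0 < δ ∧ ∀ η : ℂ, ‖η - η₀‖ < δ → ∃ 𝒢, StableSet μ η n 𝒢 := by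
  -- For μ = −1 the factor 1 − p must stay positive, so p is cut off at η₀/(1 + η₀) < 1, the largest
  -- ratio possible when the product is at most 1. Otherwise 1 must be allowed.
  obtain ⟨pm, hpm0, hpm1, hpm, hpm'⟩ : ∃ pm : ℝ, 0 ≤ pm ∧ pm ≤ 1 ∧ (μ ≠ -1 → pm = 1) ∧
      (μ = -1 → pm = η₀ / (1 + η₀)) := by
    by_cases h : μ = -1
    · exact ⟨η₀ / (1 + η₀), by positivity, by rw [div_le_one (by positivity)]; linarith,
        fun h' => absurd h h', fun _ => rfl⟩
    · exact ⟨1, zero_le_one, le_rfl, fun _ => rfl, fun h' => absurd h' h⟩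
  have hpos : ∀ p ∈ Set.Icc 0 pm, 0 < 1 + μ * p := by
    intro p hp
    by_cases h : μ = -1
    · have h1 : pm < 1 := by
        rw [hpm' h, div_lt_one (by positivity)]
        linarith
      rw [h]
      linarith [hp.2]
    · have h1 : -1 < μ := lt_of_le_of_ne hμ (Ne.symm h)
      rw [hpm h] at hp
      rcases eq_or_lt_of_le hp.1 with h0 | h0
      · rw [← h0]
        norm_num
      · nlinarith [hp.2]
  refine exists_stableSet_near_pos hn hη₀ hpm0 hpm1 hpm hpos ?_
    (contraction_of_univariate hn hμ hpm1 hpm0 hpos ?_)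
  · intro p hp
    have hprod : 0 < ∏ i, (1 + μ * p i) := Finset.prod_pos fun i _ => hpos _ (hp i)
    by_cases h : μ = -1
    · have h1 : ∏ i, (1 + μ * p i) ≤ 1 :=
        Finset.prod_le_one (fun i _ => (hpos _ (hp i)).le) fun i _ => by
          rw [h]
          linarith [(hp i).1]
      rw [hpm' h, div_mul_eq_mul_div, le_div_iff₀ (by positivity)]
      nlinarith
    · rw [hpm h]
      linarith
  · intro p hp
    have hT := hpos p hp
    have hF : 0 < η₀ * (1 + μ * p) ^ n := by positivity
    -- The endpoints p = 0 and p = 1 are not of the form e^{-s} with 0 < s < ∞; there p log p = 0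
    -- and the inequality is immediate.
    rcases eq_or_lt_of_le hp.1 with h0 | h0
    · rw [← h0, Real.negMulLog_zero]
      have : 0 < Real.log (1 + η₀⁻¹) := Real.log_pos (by linarith [inv_pos.2 hη₀])
      simp only [mul_zero, zero_div, add_zero, one_pow, mul_one]
      positivity
    rcases eq_or_lt_of_le (hp.2.trans hpm1) with h1 | h1
    · rw [h1, mul_one] at hF ⊢
      rw [Real.negMulLog_one, mul_zero, zero_div, mul_zero]
      have : 0 < Real.log (1 + (η₀ * (1 + μ) ^ n)⁻¹) :=
        Real.log_pos (by linarith [inv_pos.2 hF])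
      positivity
    have hs : 0 < -Real.log p := by linarith [Real.log_neg h0 h1]
    have := H _ hs
    rw [rate, growth, neg_neg, Real.exp_log h0] at this
    have h2 : η₀⁻¹ / (1 + μ * p) ^ n = (η₀ * (1 + μ * p) ^ n)⁻¹ := by
      rw [mul_inv, div_eq_mul_inv]
    rw [h2] at this
    generalize η₀ * (1 + μ * p) ^ n = F at *
    have h3 : (1 + F) * Real.log (1 + F⁻¹) = (1 + F⁻¹) * Real.log (1 + F⁻¹) / F⁻¹ := by
      field_simp
      ring
    rw [h3]
    refine lt_of_eq_of_lt ?_ this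
    rw [Real.negMulLog]
    ring

end SetCover

theorem mainTheorem2 (Δ : ℕ) (hΔ : 2 ≤ Δ) (μ : ℝ) (hμ : -1 ≤ μ) :
    -- the thresholds are well defined
    (SetCover.mu1 Δ < μ →
      IsLeast (SetCover.solutions1 Δ μ) (SetCover.x1 Δ μ) ∧
      (∃! y : ℝ, 0 < y ∧ SetCover.psi y = SetCover.arg1 Δ μ) ∧
      0 < SetCover.eta1 Δ μ) ∧
    (μ < SetCover.mu2 Δ →
      IsGreatest (SetCover.solutions2 Δ μ) (SetCover.x2 Δ μ) ∧
      (∃! y : ℝ, 0 < y ∧ SetCover.psi y = SetCover.arg2 Δ μ) ∧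
      0 < SetCover.eta2 Δ μ) ∧
    -- zero-freeness
    ∀ η₀ : ℝ, 0 < η₀ →
      (μ ∈ Set.Icc (SetCover.mu2 Δ) (SetCover.mu1 Δ) ∨
        (SetCover.mu1 Δ < μ ∧ η₀ < SetCover.eta1 Δ μ) ∨
        (μ < SetCover.mu2 Δ ∧ η₀ < SetCover.eta2 Δ μ)) →
      ∃ δ : ℝ, 0 < δ ∧
        ∀ η : ℂ, η ∈ Metric.thickening δ ((fun t : ℝ => (t : ℂ)) '' Set.Icc 0 η₀) → η ≠ 0 →
          ∀ (V E : Type*) [Fintype V] [DecidableEq V] [Fintype E] (G : CoverHypergraph V E),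
            (∀ v : V, G.degree v ≤ Δ) →
            ∀ (S : Finset V) (τ : S → Fin 2), G.Feasible μ S τ →
              G.partitionFunction μ η S τ ≠ 0 := by
  obtain ⟨n, rfl⟩ : ∃ n, Δ = n + 1 := ⟨Δ - 1, by omega⟩
  have hn : 1 ≤ n := by omega
  have h1 : SetCover.mu1 (n + 1) < μ → ∃ y : ℝ, 0 < y ∧
      IsLeast (SetCover.solutions1 (n + 1) μ) (SetCover.x1 (n + 1) μ) ∧
      SetCover.psi y = SetCover.arg1 (n + 1) μ ∧ 0 < SetCover.eta1 (n + 1) μ ∧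
      ∀ C, (SetCover.eta1 (n + 1) μ)⁻¹ < C → ∀ s, 0 < s →
        SetCover.rate n μ s < SetCover.growth (C / (1 + μ * Real.exp (-s)) ^ n) := by
    intro h
    obtain ⟨s, y, hs, hy, hleast, hpsi, hmax⟩ := SetCover.exists_threshold_of_mu1_lt hn h
    have hx : SetCover.x1 (n + 1) μ = s := hleast.csInf_eq
    have harg : SetCover.psi y = SetCover.arg1 (n + 1) μ := by rw [SetCover.arg1, hx, hpsi]
    have heta : SetCover.eta1 (n + 1) μ = (y * (1 + μ * Real.exp (-s)) ^ n)⁻¹ := by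
      rw [SetCover.eta1, SetCover.psiInv_eq hy harg, hx, Nat.add_sub_cancel]
    refine ⟨y, hy, hx ▸ hleast, harg, ?_, ?_⟩
    · have := SetCover.one_add_mul_exp_pos hμ hs
      rw [heta]
      positivity
    · rwa [heta, inv_inv]
  have h2 : μ < SetCover.mu2 (n + 1) → ∃ y : ℝ, 0 < y ∧
      IsGreatest (SetCover.solutions2 (n + 1) μ) (SetCover.x2 (n + 1) μ) ∧
      SetCover.psi y = SetCover.arg2 (n + 1) μ ∧ 0 < SetCover.eta2 (n + 1) μ ∧
      ∀ C, (SetCover.eta2 (n + 1) μ)⁻¹ < C → ∀ s, 0 < s →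
        SetCover.rate n μ s < SetCover.growth (C / (1 + μ * Real.exp (-s)) ^ n) := by
    intro h
    obtain ⟨s, y, hs, hy, hgreat, hpsi, hmax⟩ := SetCover.exists_threshold_of_lt_mu2 hn hμ h
    have hx : SetCover.x2 (n + 1) μ = s := hgreat.csSup_eq
    have harg : SetCover.psi y = SetCover.arg2 (n + 1) μ := by rw [SetCover.arg2, hx, hpsi]
    have heta : SetCover.eta2 (n + 1) μ = (y * (1 + μ * Real.exp (-s)) ^ n)⁻¹ := by
      rw [SetCover.eta2, SetCover.psiInv_eq hy harg, hx, Nat.add_sub_cancel]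
    refine ⟨y, hy, hx ▸ hgreat, harg, ?_, ?_⟩
    · have := SetCover.one_add_mul_exp_pos hμ hs
      rw [heta]
      positivity
    · rwa [heta, inv_inv]
  refine ⟨fun h => ?_, fun h => ?_, fun η₀ hη₀ hcases => ?_⟩
  · obtain ⟨y, hy, hleast, harg, hpos, -⟩ := h1 h
    exact ⟨hleast, SetCover.existsUnique_psi_eq hy harg, hpos⟩
  · obtain ⟨y, hy, hgreat, harg, hpos, -⟩ := h2 h
    exact ⟨hgreat, SetCover.existsUnique_psi_eq hy harg, hpos⟩
  have hcontr : ∀ t : ℝ, 0 < t → t ≤ η₀ → ∀ s, 0 < s →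
      SetCover.rate n μ s < SetCover.growth (t⁻¹ / (1 + μ * Real.exp (-s)) ^ n) := by
    intro t ht htη s hs
    rcases hcases with h | ⟨h, hη⟩ | ⟨h, hη⟩
    · have hT := SetCover.one_add_mul_exp_pos hμ hs
      exact (SetCover.rate_le_one hn hμ h hs).trans_lt (SetCover.one_lt_growth (by positivity))
    · obtain ⟨_, _, _, _, hpos, hmax⟩ := h1 h
      exact hmax _ ((inv_lt_inv₀ hpos ht).2 (htη.trans_lt hη)) s hs
    · obtain ⟨_, _, _, _, hpos, hmax⟩ := h2 h
      exact hmax _ ((inv_lt_inv₀ hpos ht).2 (htη.trans_lt hη)) s hs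
  -- Each point of [0, η₀] has a neighbourhood of activities admitting a stable set. Compactness
  -- gives one δ, and it depends on n, μ, η₀ only since stable sets do not involve the hypergraph.
  have hcompact : IsCompact ((fun t : ℝ => (t : ℂ)) '' Set.Icc 0 η₀) :=
    isCompact_Icc.image Complex.continuous_ofReal
  have hsub : (fun t : ℝ => (t : ℂ)) '' Set.Icc 0 η₀ ⊆
      interior {η : ℂ | ∃ 𝒢, StableSet (μ : ℂ) η n 𝒢} := by
    rintro _ ⟨t, ht, rfl⟩
    rw [mem_interior_iff_mem_nhds, Metric.mem_nhds_iff]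
    obtain ⟨δ, hδ, h⟩ : ∃ δ : ℝ, 0 < δ ∧ ∀ η : ℂ, ‖η - t‖ < δ → ∃ 𝒢, StableSet (μ : ℂ) η n 𝒢 := by
      rcases eq_or_lt_of_le ht.1 with rfl | h0
      · simpa using exists_stableSet_near_zero hμ n
      · exact SetCover.exists_stableSet hn hμ h0 (hcontr t h0 ht.2)
    exact ⟨δ, hδ, fun η hη => h η (by rwa [← dist_eq_norm])⟩
  obtain ⟨δ, hδ, hthick⟩ := hcompact.exists_thickening_subset_open isOpen_interior hsub
  refine ⟨δ, hδ, fun η hη hη0 V E _ _ _ G hdeg S τ hτ => ?_⟩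
  obtain ⟨𝒢, h𝒢⟩ := interior_subset (hthick hη)
  exact h𝒢.partitionFunction_ne_zero hη0 G hdeg S τ hτ
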